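/- Fix an integer $p\ge 2$. Let $(g_{i_1\ldots i_p})_{1\le i_1<\cdots<i_p<\infty}$ be independent standard Gaussian random variables, extended symmetrically to all $p$-tuples of pairwise distinct indices. For $N\ge 1$ let $J_{i_1\ldots i_p}=N^{\frac{1-p}{2}}g_{i_1\ldots i_p}$ if $i_1,\ldots,i_p\in\{1,\ldots,N\}$ are pairwise distinct, and $J_{i_1\ldots i_p}=0$ if two of the indices coincide. For $\boldsymbol x\in\{-1,1\}^N$ put $$H_N(\boldsymbol x)=\sum_{1\le i_1,\ldots,i_p\le N}J_{i_1\ldots i_p}x_{i_1}\cdots x_{i_p},\qquad m_i(\boldsymbol x)=\sum_{1\le i_2,\ldots,i_p\le N}J_{i i_2\ldots i_p}x_{i_2}\cdots x_{i_p}.$$ Given the disorder $g$, the $p$-spin Sherrington–Kirkpatrick model at inverse temperature $\beta$ is the probability measure $\mathbb P_\beta$ on $\{-1,1\}^N$ with $\mathbb P_\beta(\boldsymbol x)\propto e^{\beta H_N(\boldsymbol x)}$, and the maximum pseudolikelihood (MPL) estimate of $\beta$ based on a single sample $\boldsymbol X\sim\mathbb P_\beta$ is $$\hat\beta_N(\boldsymbol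 X)=\inf\Big\{b\ge 0:\ H_N(\boldsymbol X)=\sum_{i=1}^N m_i(\boldsymbol X)\tanh\big(p\,b\,m_i(\boldsymbol X)\big)\Big\},\qquad \inf\emptyset=+\infty.$$ Then the MPL estimate is $\sqrt N$-consistent at every $\beta>0$, for almost every realization of the disorder: there are constants $M(\beta,\delta)>0$, for $\beta,\delta>0$, depending only on $p,\beta,\delta$, such that for almost every realization of $g$ the following holds for all $\beta>0$ and all $\delta>0$: $$\mathbb P_\beta\big(\sqrt N\,|\hat\beta_N(\boldsymbol X)-\beta|\le M(\beta,\delta)\big)>1-\delta\qquad\text{for all sufficiently large }N,$$ where how large $N$ has to be may depend on $\beta$, $\delta$ and the realization of $g$. -/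

import Mathlib

open Filter MeasureTheory ProbabilityTheory

noncomputable section

namespace TensorIsing

/-- Spin configurations in `{-1, 1}^N`; the two-point set `{-1, 1}` is `ℤˣ`. -/
abbrev Config (N : ℕ) : Type := Fin N → ℤˣ

/-- The spin `x_i` as a real number. -/
def spin {N : ℕ} (x : Config N) (i : Fin N) : ℝ := ((x i : ℤ) : ℝ)

/-- Real tensors of order `p` on the vertex set `Fin N`. -/
abbrev Tensor (p N : ℕ) : Type := (Fin p → Fin N) → ℝ

variable {p N : ℕ}

/-- The Hamiltonian `H_N(x)`: the sum over all `p`-tuples `(i_1, …, i_p)` of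
`J_{i_1 … i_p} x_{i_1} ⋯ x_{i_p}`. -/
def hamiltonian (J : Tensor p N) (x : Config N) : ℝ :=
  ∑ i : Fin p → Fin N, J i * ∏ k, spin x (i k)

/-- The partition function `Z_N(β) = 2^{-N} ∑_x exp (β H_N(x))`. -/
def partitionFunction (J : Tensor p N) (β : ℝ) : ℝ :=
  1 / 2 ^ N * ∑ x : Config N, Real.exp (β * hamiltonian J x)

/-- The probability of the configuration `x` under the `p`-tensor Ising model with
interaction tensor `J` and inverse temperature `β`. -/
def gibbsMass (J : Tensor p N) (β : ℝ) (x : Config N) : ℝ :=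
  1 / (2 ^ N * partitionFunction J β) * Real.exp (β * hamiltonian J x)

open Classical in
/-- The probability of the event `A` under the `p`-tensor Ising model. -/
def gibbsProb (J : Tensor p N) (β : ℝ) (A : Set (Config N)) : ℝ :=
  ∑ x : Config N with x ∈ A, gibbsMass J β x

/-- The local field `m_i(x)`: the sum over all `p`-tuples `(i_1, …, i_p)` with `i_1 = i` of
`J_{i_1 … i_p} x_{i_2} ⋯ x_{i_p}`. -/
def localField [NeZero p] (J : Tensor p N) (x : Config N) (i : Fin N) : ℝ :=
  ∑ t : Fin p → Fin N with t 0 = i, J t * ∏ k ∈ Finset.univ.erase 0, spin x (t k)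

/-- The maximum pseudolikelihood estimate: the smallest `b ≥ 0` solving the
pseudolikelihood equation `H_N(x) = ∑_i m_i(x) tanh (p b m_i(x))`, and `+∞` if there is none. -/
def mple [NeZero p] (J : Tensor p N) (x : Config N) : EReal :=
  sInf {b : EReal | ∃ c : ℝ, b = (c : EReal) ∧ 0 ≤ c ∧
    hamiltonian J x = ∑ i, localField J x i * Real.tanh (p * c * localField J x i)}

/-- The index set of the disorder: `p`-element sets of naturals, that is, increasing tuples
`i_1 < ⋯ < i_p`. -/
abbrev DisorderIndex (p : ℕ) : Type := {s : Finset ℕ // s.card = p}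

/-- The interaction tensor of the `p`-spin Sherrington-Kirkpatrick model on `N` vertices with
disorder `γ`: the entry at `(i_1, …, i_p)` is `N^{(1-p)/2} γ_{{i_1, …, i_p}}` if the indices are
pairwise distinct, and `0` otherwise. The same `γ` is used for every `N`. -/
def skTensor (p : ℕ) (γ : DisorderIndex p → ℝ) (N : ℕ) : Tensor p N := by
  classical
  exact fun i =>
    if h : Function.Injective i then
      (N : ℝ) ^ ((1 - (p : ℝ)) / 2) *
        γ ⟨Finset.univ.map ((⟨i, h⟩ : Fin p ↪ Fin N).trans Fin.valEmbedding), by simp⟩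
    else 0

end TensorIsing

end

noncomputable section

namespace TensorIsing

/-! Write `c_i = x_i m_i` for the cavity fields and `φ(y) = y (1 - tanh (p b y))`. The
pseudolikelihood equation says that the score `S_b = ∑ φ(c_i)` vanishes. The rate `√N` comes from
two facts: `S_β` is of order `√N` with high Gibbs probability, and `S_b` decreases in `b` at a rate
of order `N` near `β`.

For the first, reversing the spin `i` sends `c_i` to `-c_i` and multiplies the Gibbs weight by `exp
(-2 p β c_i)`, which `φ` balances exactly (`siteScore_neg_mul_exp`). Hence `2 E S² = E ∑ φ(c_i)
(S(x) - S(x^i))`, where `x^i` is `x` with spin `i` reversed. By Taylor expansion the sum is a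
bilinear form in the coupling matrix plus terms of order `N`, so it is `O(N)` once these matrices
have bounded operator norm (`CouplingBound`). For the second, it suffices that a positive proportion
of the fields is bounded and bounded away from zero (`FieldsSpread`).

Both conditions are imposed on all configurations at once, so nothing has to be known about the
Gibbs measure, at any temperature. They fail with exponentially small probability, even after a
union over the `2 ^ N` configurations: the norm is controlled by Gaussian tails on a set of integer
vectors (`measure_not_couplingBound_le`), the fields by a small ball estimate using disorder
variables private to each vertex (`measure_not_fieldsLarge_le`). Borel–Cantelli then gives one
almost sure event, which serves all `β` and `δ`. -/

/-! ### Calculus of the one-site score -/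

theorem hasDerivAt_tanh (y : ℝ) : HasDerivAt Real.tanh (1 - Real.tanh y ^ 2) y := by
  have h := (Real.hasDerivAt_sinh y).div (Real.hasDerivAt_cosh y) (Real.cosh_pos y).ne'
  have he : Real.tanh = Real.sinh / Real.cosh := by
    ext z; exact Real.tanh_eq_sinh_div_cosh z
  rw [he]
  refine h.congr_deriv ?_
  have hc := (Real.cosh_pos y).ne'
  simp only [Pi.div_apply]
  field_simp

theorem one_sub_tanh_sq (y : ℝ) : 1 - Real.tanh y ^ 2 = 1 / Real.cosh y ^ 2 := by
  have hc := (Real.cosh_pos y).ne'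
  rw [Real.tanh_eq_sinh_div_cosh]
  field_simp
  linarith [Real.cosh_sq y]

theorem abs_le_cosh (y : ℝ) : |y| ≤ Real.cosh y := by
  rw [← Real.cosh_abs]
  exact (Real.self_le_sinh_iff.2 (abs_nonneg y)).trans (Real.sinh_lt_cosh _).le

theorem abs_mul_one_sub_tanh_sq_le (y : ℝ) : |y| * (1 - Real.tanh y ^ 2) ≤ 1 := by
  rw [one_sub_tanh_sq, mul_one_div, div_le_one (by positivity [Real.cosh_pos y])]
  nlinarith [abs_le_cosh y, Real.one_le_cosh y]

/-- The contribution of a site with aligned field `y` to the score at parameter `q`. -/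
def siteScore (q y : ℝ) : ℝ := y * (1 - Real.tanh (q * y))

/-- The derivative of `siteScore q`. -/
def siteSlope (q y : ℝ) : ℝ :=
  1 - Real.tanh (q * y) - q * y * (1 - Real.tanh (q * y) ^ 2)

theorem hasDerivAt_tanh_mul (q y : ℝ) :
    HasDerivAt (fun z => Real.tanh (q * z)) ((1 - Real.tanh (q * y) ^ 2) * q) y := by
  have h := (hasDerivAt_tanh (q * y)).comp y ((hasDerivAt_id y).const_mul q)
  simpa [Function.comp_def] using h

theorem hasDerivAt_siteScore (q y : ℝ) : HasDerivAt (siteScore q) (siteSlope q y) y := by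
  have h := (hasDerivAt_id y).mul ((hasDerivAt_tanh_mul q y).const_sub 1)
  refine h.congr_deriv ?_
  simp only [id, siteSlope]
  ring

theorem hasDerivAt_siteSlope (q y : ℝ) : HasDerivAt (siteSlope q)
    (-2 * q * (1 - Real.tanh (q * y) ^ 2) +
      2 * q * (q * y * (1 - Real.tanh (q * y) ^ 2)) * Real.tanh (q * y)) y := by
  have h1 := hasDerivAt_tanh_mul q y
  have h := (h1.const_sub 1).sub
    (((hasDerivAt_id y).const_mul q).mul ((h1.pow 2).const_sub 1))
  refine h.congr_deriv ?_
  simp only [id, Pi.pow_apply]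
  push_cast
  ring

theorem abs_siteScore_le (q y : ℝ) : |siteScore q y| ≤ 2 * |y| := by
  rw [siteScore, abs_mul, mul_comm]
  gcongr
  have := abs_lt.1 (Real.abs_tanh_lt_one (q * y))
  rw [abs_le]; constructor <;> linarith

theorem abs_siteSlope_le (q y : ℝ) : |siteSlope q y| ≤ 3 := by
  have h1 := abs_lt.1 (Real.abs_tanh_lt_one (q * y))
  have h2 := abs_mul_one_sub_tanh_sq_le (q * y)
  have h3 := Real.tanh_sq_lt_one (q * y)
  have h4 : |q * y * (1 - Real.tanh (q * y) ^ 2)| ≤ 1 := by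
    rwa [abs_mul, abs_of_nonneg (a := 1 - Real.tanh (q * y) ^ 2) (by linarith)]
  have h5 := abs_le.1 h4
  rw [siteSlope, abs_le]
  constructor <;> linarith

theorem abs_siteSlope_deriv_le {q : ℝ} (hq : 0 ≤ q) (y : ℝ) :
    |-2 * q * (1 - Real.tanh (q * y) ^ 2) +
      2 * q * (q * y * (1 - Real.tanh (q * y) ^ 2)) * Real.tanh (q * y)| ≤ 4 * q := by
  have h1 := Real.abs_tanh_lt_one (q * y)
  have h2 := abs_mul_one_sub_tanh_sq_le (q * y)
  have h3 := Real.tanh_sq_lt_one (q * y)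
  have h4 : |q * y * (1 - Real.tanh (q * y) ^ 2)| ≤ 1 := by
    rwa [abs_mul, abs_of_nonneg (a := 1 - Real.tanh (q * y) ^ 2) (by linarith)]
  have h5 : |(q * y * (1 - Real.tanh (q * y) ^ 2)) * Real.tanh (q * y)| ≤ 1 := by
    rw [abs_mul]; nlinarith [abs_nonneg (Real.tanh (q * y))]
  have h6 := abs_le.1 h5
  have h7 := sq_nonneg (Real.tanh (q * y))
  rw [abs_le]
  constructor <;> nlinarith

/-- First-order Taylor expansion at `y`. The second derivative is bounded by `4 q` because `|z| (1 -
tanh² z) ≤ 1`; the factor `1/2` of the sharp remainder is given away. -/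
theorem abs_siteScore_sub_le {q : ℝ} (hq : 0 ≤ q) (y k : ℝ) :
    |siteScore q y - siteScore q (y - k) - k * siteSlope q y| ≤ 4 * q * k ^ 2 := by
  have hslope : ∀ z, |siteSlope q z - siteSlope q y| ≤ 4 * q * |z - y| := fun z => by
    have := convex_univ.norm_image_sub_le_of_norm_hasDerivWithin_le
      (fun w _ => (hasDerivAt_siteSlope q w).hasDerivWithinAt)
      (fun w _ => abs_siteSlope_deriv_le hq w) (Set.mem_univ y) (Set.mem_univ z)
    simpa using this
  -- Subtracting the tangent leaves a function whose derivative is at most `4 q |k|` between `y - k`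
  -- and `y`.
  have h := (convex_uIcc (y - k) y).norm_image_sub_le_of_norm_hasDerivWithin_le
    (f := fun z => siteScore q z - z * siteSlope q y)
    (f' := fun z => siteSlope q z - 1 * siteSlope q y) (C := 4 * q * |k|)
    (fun w _ => ((hasDerivAt_siteScore q w).sub
      ((hasDerivAt_id w).mul_const (siteSlope q y))).hasDerivWithinAt)
    (fun w hw => by
      rw [one_mul]
      refine (hslope w).trans ?_
      have : |w - y| ≤ |k| := by
        have := Set.abs_sub_right_of_mem_uIcc hw
        rw [abs_sub_comm]
        simpa using this
      gcongr)
    Set.left_mem_uIcc Set.right_mem_uIcc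
  have e : siteScore q y - siteScore q (y - k) - k * siteSlope q y =
    (siteScore q y - y * siteSlope q y) -
      (siteScore q (y - k) - (y - k) * siteSlope q y) := by ring
  rw [e]
  refine h.trans (le_of_eq ?_)
  rw [sub_sub_cancel, Real.norm_eq_abs, mul_assoc, ← sq, sq_abs]

/-- The two values of the site score at opposite fields balance under the Gibbs weights. -/
theorem siteScore_neg_mul_exp (q y : ℝ) :
    siteScore q (-y) * Real.exp (-2 * (q * y)) = -siteScore q y := by
  have h1 := Real.exp_pos (q * y)
  have h2 : Real.exp (-(q * y)) = (Real.exp (q * y))⁻¹ := Real.exp_neg _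
  have h3 : Real.exp (-2 * (q * y)) = (Real.exp (q * y))⁻¹ ^ 2 := by
    rw [← h2, ← Real.exp_nat_mul]; congr 1; push_cast; ring
  -- The identity behind this is `(1 + tanh z) exp (-2 z) = 1 - tanh z`.
  rw [siteScore, siteScore, mul_neg, Real.tanh_neg, Real.tanh_eq, h2, h3]
  field_simp
  ring

/-! ### Energy, cavity fields and couplings under a spin flip -/

/-- The `p`-element subsets of the vertex set `Fin N`. -/
abbrev Block (p N : ℕ) : Type := {s : Finset (Fin N) // s.card = p}

/-- The product of the spins over a set of vertices. -/
def spinProd {N : ℕ} (x : Config N) (s : Finset (Fin N)) : ℝ := ∏ i ∈ s, spin x i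

/-- The energy of a configuration with one coupling constant per `p`-set. -/
def energy {p N : ℕ} (h : Block p N → ℝ) (x : Config N) : ℝ := ∑ s, h s * spinProd x s.1

/-- The part of the energy that involves the vertex `i`. -/
def cavity {p N : ℕ} (h : Block p N → ℝ) (x : Config N) (i : Fin N) : ℝ :=
  ∑ s, if i ∈ s.1 then h s * spinProd x s.1 else 0

/-- The part of the energy that involves both `i` and `j`, with zero diagonal. -/
def coupling {p N : ℕ} (h : Block p N → ℝ) (x : Config N) (i j : Fin N) : ℝ :=
  if i = j then 0 else ∑ s, if i ∈ s.1 ∧ j ∈ s.1 then h s * spinProd x s.1 else 0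

/-- The configuration with the spin at `i` reversed. -/
def flip {N : ℕ} (x : Config N) (i : Fin N) : Config N := Function.update x i (-x i)

section Spins

variable {p N : ℕ}

theorem spin_mul_self (x : Config N) (i : Fin N) : spin x i * spin x i = 1 := by
  rcases Int.units_eq_one_or (x i) with h | h <;> simp [spin, h]

theorem spinProd_mul_self (x : Config N) (s : Finset (Fin N)) :
    spinProd x s * spinProd x s = 1 := by
  rw [spinProd, ← Finset.prod_mul_distrib]
  exact Finset.prod_eq_one fun i _ => spin_mul_self x i

theorem flip_flip (x : Config N) (i : Fin N) : flip (flip x i) i = x := by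
  simp [flip]

theorem spin_flip (x : Config N) (i j : Fin N) :
    spin (flip x i) j = if j = i then -spin x j else spin x j := by
  by_cases h : j = i
  · subst h; simp [spin, flip]
  · simp [spin, flip, h]

theorem spinProd_flip (x : Config N) (i : Fin N) (s : Finset (Fin N)) :
    spinProd (flip x i) s = if i ∈ s then -spinProd x s else spinProd x s := by
  split_ifs with h
  · rw [spinProd, spinProd, ← Finset.mul_prod_erase s _ h, ← Finset.mul_prod_erase s _ h,
      spin_flip, if_pos rfl, neg_mul]
    congr 2
    refine Finset.prod_congr rfl fun j hj => ?_
    rw [spin_flip, if_neg (Finset.ne_of_mem_erase hj)]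
  · refine Finset.prod_congr rfl fun j hj => ?_
    rw [spin_flip, if_neg]
    rintro rfl
    exact h hj

theorem energy_flip (h : Block p N → ℝ) (x : Config N) (i : Fin N) :
    energy h (flip x i) = energy h x - 2 * cavity h x i := by
  rw [energy, energy, cavity, Finset.mul_sum, ← Finset.sum_sub_distrib]
  refine Finset.sum_congr rfl fun s _ => ?_
  rw [spinProd_flip]
  split_ifs <;> ring

theorem cavity_flip_self (h : Block p N → ℝ) (x : Config N) (i : Fin N) :
    cavity h (flip x i) i = -cavity h x i := by
  rw [cavity, cavity, ← Finset.sum_neg_distrib]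
  refine Finset.sum_congr rfl fun s _ => ?_
  rw [spinProd_flip]
  split_ifs <;> ring

theorem cavity_flip_of_ne (h : Block p N → ℝ) (x : Config N) {i j : Fin N} (hij : i ≠ j) :
    cavity h (flip x i) j = cavity h x j - 2 * coupling h x i j := by
  rw [cavity, cavity, coupling, if_neg hij, Finset.mul_sum, ← Finset.sum_sub_distrib]
  refine Finset.sum_congr rfl fun s _ => ?_
  rw [spinProd_flip]
  by_cases h1 : i ∈ s.1 <;> by_cases h2 : j ∈ s.1 <;> simp [h1, h2]
  ring

theorem coupling_self (h : Block p N → ℝ) (x : Config N) (i : Fin N) :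
    coupling h x i i = 0 := if_pos rfl

theorem sum_cavity (h : Block p N → ℝ) (x : Config N) :
    ∑ i, cavity h x i = p * energy h x := by
  simp only [cavity, energy]
  rw [Finset.sum_comm, Finset.mul_sum]
  refine Finset.sum_congr rfl fun s _ => ?_
  rw [← Finset.sum_filter, Finset.sum_const, Finset.filter_mem_eq_inter, Finset.univ_inter,
    s.2, nsmul_eq_mul]

/-- A block containing `i` is counted once for each of its `p - 1` other vertices. This is how
operator norm bounds on the couplings reach the fields. -/
theorem sum_coupling (h : Block p N → ℝ) (x : Config N) (i : Fin N) :
    ∑ j, coupling h x i j = ((p : ℝ) - 1) * cavity h x i := by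
  have e : ∀ j, coupling h x i j =
      (∑ s : Block p N, if i ∈ s.1 ∧ j ∈ s.1 then h s * spinProd x s.1 else 0) -
        if j = i then cavity h x i else 0 := fun j => by
    rw [coupling]
    by_cases hj : i = j
    · subst hj; simp [cavity]
    · rw [if_neg hj, if_neg (Ne.symm hj), sub_zero]
  rw [Finset.sum_congr rfl fun j _ => e j, Finset.sum_sub_distrib,
    Finset.sum_ite_eq' Finset.univ i, if_pos (Finset.mem_univ _), sub_mul, one_mul,
    Finset.sum_comm, cavity, Finset.mul_sum]
  congr 1
  refine Finset.sum_congr rfl fun s _ => ?_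
  by_cases hi : i ∈ s.1
  · simp only [hi, true_and, if_true]
    rw [← Finset.sum_filter, Finset.sum_const, Finset.filter_mem_eq_inter, Finset.univ_inter,
      s.2, nsmul_eq_mul]
  · simp [hi]

end Spins

/-! ### From the symmetric tensor to couplings on blocks -/

theorem card_perm_apply_zero_eq (n : ℕ) (a : Fin (n + 1)) :
    (Finset.univ.filter fun σ : Equiv.Perm (Fin (n + 1)) => σ 0 = a).card = n.factorial := by
  have : (Finset.univ.filter fun σ : Equiv.Perm (Fin (n + 1)) => σ 0 = a).card =
      (({a} : Finset (Fin (n + 1))) ×ˢ (Finset.univ : Finset (Equiv.Perm (Fin n)))).card := by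
    refine Finset.card_equiv Equiv.Perm.decomposeFin fun σ => ?_
    obtain ⟨⟨b, τ⟩, rfl⟩ := Equiv.Perm.decomposeFin.symm.surjective σ
    simp [Equiv.Perm.decomposeFin_symm_apply_zero, eq_comm]
  rw [this]
  simp [Fintype.card_perm]

theorem card_enumerations {p N : ℕ} [NeZero p] (s : Block p N) {i : Fin N} (hi : i ∈ s.1) :
    (Finset.univ.filter fun t : Fin p → Fin N =>
      (Function.Injective t ∧ Finset.univ.image t = s.1) ∧ t 0 = i).card =
        (p - 1).factorial := by
  obtain ⟨n, rfl⟩ : ∃ n, p = n + 1 := ⟨p - 1, (Nat.succ_pred (NeZero.ne p)).symm⟩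
  let e : Fin (n + 1) ≃ s.1 := (s.1.equivFinOfCardEq s.2).symm
  rw [Nat.add_sub_cancel, ← card_perm_apply_zero_eq n (e.symm ⟨i, hi⟩)]
  symm
  refine Finset.card_bij (fun σ _ k => (e (σ k) : Fin N)) ?_ ?_ ?_
  · intro σ hσ
    simp only [Finset.mem_filter, Finset.mem_univ, true_and] at hσ ⊢
    refine ⟨⟨fun a b hab => σ.injective (e.injective (Subtype.ext hab)), ?_⟩, ?_⟩
    · ext v
      simp only [Finset.mem_image, Finset.mem_univ, true_and]
      constructor
      · rintro ⟨k, rfl⟩; exact (e (σ k)).2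
      · intro hv
        exact ⟨σ.symm (e.symm ⟨v, hv⟩), by simp⟩
    · simp [hσ]
  · intro σ _ τ _ hst
    ext k
    have := congrFun hst k
    exact congrArg Fin.val (e.injective (Subtype.ext this))
  · intro t ht
    simp only [Finset.mem_filter, Finset.mem_univ, true_and] at ht
    obtain ⟨⟨hinj, him⟩, h0⟩ := ht
    have hmem : ∀ k, t k ∈ s.1 := fun k => him ▸ Finset.mem_image_of_mem t (Finset.mem_univ k)
    have hb : Function.Injective fun k => e.symm ⟨t k, hmem k⟩ := fun a b hab =>
      hinj (congrArg Subtype.val (e.symm.injective hab))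
    refine ⟨Equiv.ofBijective _ (Finite.injective_iff_bijective.1 hb), ?_, ?_⟩
    · simp [h0]
    · ext k; simp

/-- The coupling constant of a `p`-set in the Sherrington-Kirkpatrick model, normalised so that
the local fields are the signed cavity sums. -/
def skCoupling (p : ℕ) (γ : DisorderIndex p → ℝ) (N : ℕ) (s : Block p N) : ℝ :=
  (p - 1).factorial * (N : ℝ) ^ ((1 - (p : ℝ)) / 2) *
    γ ⟨s.1.map Fin.valEmbedding, by simp [s.2]⟩

/-- Each block containing `i` has `(p - 1)!` enumerations starting with `i`, and `x_i² = 1`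
completes the product over the other vertices to the whole block. -/
theorem localField_skTensor {p N : ℕ} [NeZero p] (γ : DisorderIndex p → ℝ) (x : Config N)
    (i : Fin N) :
    localField (skTensor p γ N) x i = spin x i * cavity (skCoupling p γ N) x i := by
  classical
  set c : ℝ := (N : ℝ) ^ ((1 - (p : ℝ)) / 2) with hc
  have hterm : ∀ s : Block p N, ∀ t : Fin p → Fin N,
      (Function.Injective t ∧ Finset.univ.image t = s.1) ∧ t 0 = i →
      skTensor p γ N t * ∏ k ∈ Finset.univ.erase 0, spin x (t k) =
        spin x i * (c * γ ⟨s.1.map Fin.valEmbedding, by simp [s.2]⟩ * spinProd x s.1) := by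
    rintro s t ⟨⟨hinj, him⟩, rfl⟩
    have h1 : spinProd x s.1 = spin x (t 0) * ∏ k ∈ Finset.univ.erase 0, spin x (t k) := by
      rw [← him, spinProd, Finset.prod_image hinj.injOn,
        Finset.mul_prod_erase _ (fun k => spin x (t k)) (Finset.mem_univ 0)]
    have h2 : skTensor p γ N t = c * γ ⟨s.1.map Fin.valEmbedding, by simp [s.2]⟩ := by
      rw [skTensor, dif_pos hinj]
      congr 3
      rw [← him, Finset.map_eq_image, Finset.map_eq_image, Finset.image_image]
      rfl
    rw [h1, h2]
    linear_combination (-(c * γ ⟨s.1.map Fin.valEmbedding, by simp [s.2]⟩) *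
      ∏ k ∈ Finset.univ.erase 0, spin x (t k)) * spin_mul_self x (t 0)
  -- Tuples with a repeated index vanish; an injective tuple enumerates exactly one block, its
  -- image.
  have hsplit : localField (skTensor p γ N) x i = ∑ s : Block p N,
      ∑ t ∈ Finset.univ.filter fun t : Fin p → Fin N =>
        (Function.Injective t ∧ Finset.univ.image t = s.1) ∧ t 0 = i,
        skTensor p γ N t * ∏ k ∈ Finset.univ.erase 0, spin x (t k) := by
    rw [localField, Finset.sum_filter]
    simp_rw [Finset.sum_filter]
    rw [Finset.sum_comm]
    refine Finset.sum_congr rfl fun t _ => ?_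
    by_cases hinj : Function.Injective t
    · rw [Finset.sum_eq_single
        (⟨Finset.univ.image t, by rw [Finset.card_image_of_injective _ hinj]; simp⟩ : Block p N)]
      · simp [hinj]
      · intro s _ hs
        rw [if_neg]
        rintro ⟨⟨_, h⟩, _⟩
        exact hs (Subtype.ext h.symm)
      · simp
    · have : skTensor p γ N t = 0 := by rw [skTensor, dif_neg hinj]
      simp [this]
  rw [hsplit, cavity, Finset.mul_sum]
  refine Finset.sum_congr rfl fun s _ => ?_
  rw [Finset.sum_congr rfl fun t ht => hterm s t (Finset.mem_filter.1 ht).2, Finset.sum_const]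
  split_ifs with hi
  · rw [card_enumerations s hi, nsmul_eq_mul, skCoupling, ← hc]
    ring
  · rw [Finset.card_eq_zero.2, zero_smul, mul_zero]
    refine Finset.filter_eq_empty_iff.2 fun t _ => ?_
    rintro ⟨⟨_, him⟩, rfl⟩
    exact hi (him ▸ Finset.mem_image_of_mem t (Finset.mem_univ 0))

theorem hamiltonian_eq_sum_localField {p N : ℕ} [NeZero p] (J : Tensor p N) (x : Config N) :
    hamiltonian J x = ∑ i, spin x i * localField J x i := by
  rw [hamiltonian, ← Finset.sum_fiberwise Finset.univ (fun t : Fin p → Fin N => t 0)]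
  refine Finset.sum_congr rfl fun i _ => ?_
  rw [localField, Finset.mul_sum]
  refine Finset.sum_congr rfl fun t ht => ?_
  rw [← Finset.mul_prod_erase _ _ (Finset.mem_univ (0 : Fin p)), (Finset.mem_filter.1 ht).2]
  ring

theorem hamiltonian_skTensor {p N : ℕ} [NeZero p] (γ : DisorderIndex p → ℝ) (x : Config N) :
    hamiltonian (skTensor p γ N) x = p * energy (skCoupling p γ N) x := by
  rw [hamiltonian_eq_sum_localField, ← sum_cavity]
  refine Finset.sum_congr rfl fun i _ => ?_
  rw [localField_skTensor, ← mul_assoc, spin_mul_self, one_mul]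

/-- The derivative of the log-pseudolikelihood at `b`. -/
def score {p N : ℕ} (h : Block p N → ℝ) (b : ℝ) (x : Config N) : ℝ :=
  ∑ i, siteScore (p * b) (cavity h x i)

/-- `y tanh (q y)` is even in `y`, so local fields may be replaced by cavity fields. -/
theorem pseudolikelihood_equation_iff {p N : ℕ} [NeZero p] (γ : DisorderIndex p → ℝ)
    (x : Config N) (b : ℝ) :
    hamiltonian (skTensor p γ N) x = ∑ i, localField (skTensor p γ N) x i *
      Real.tanh (p * b * localField (skTensor p γ N) x i) ↔
    score (skCoupling p γ N) b x = 0 := by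
  have h1 : hamiltonian (skTensor p γ N) x = ∑ i, cavity (skCoupling p γ N) x i := by
    rw [hamiltonian_skTensor, sum_cavity]
  have h2 : ∀ i, localField (skTensor p γ N) x i *
      Real.tanh (p * b * localField (skTensor p γ N) x i) =
      cavity (skCoupling p γ N) x i * Real.tanh (p * b * cavity (skCoupling p γ N) x i) := by
    intro i
    rw [localField_skTensor]
    rcases Int.units_eq_one_or (x i) with h | h
    · simp [spin, h]
    · simp [spin, h]
  rw [h1, Finset.sum_congr rfl fun i _ => h2 i, ← sub_eq_zero, ← Finset.sum_sub_distrib, score]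
  simp only [siteScore, mul_sub, mul_one]

/-! ### Deterministic bounds from the operator norm -/

/-- The coupling matrices of all configurations have operator norm at most `C`. -/
def CouplingBound {p N : ℕ} (h : Block p N → ℝ) (C : ℝ) : Prop :=
  ∀ (x : Config N) (u v : Fin N → ℝ),
    2 * ∑ i, ∑ j, u i * v j * coupling h x i j ≤ C * (∑ i, u i ^ 2 + ∑ j, v j ^ 2)

section Bounds

variable {p N : ℕ} {h : Block p N → ℝ} {C : ℝ}

/-- The row sums of the coupling matrix are `(p - 1) c_i`, so the bound is tested on the fields
against the constant vector `C`; `p ≥ 2` lets the left side absorb `∑ c_i²`. -/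
theorem CouplingBound.sum_cavity_sq_le (hp : 2 ≤ p) (hC : 0 < C) (hb : CouplingBound h C)
    (x : Config N) : ∑ i, cavity h x i ^ 2 ≤ C ^ 2 * N := by
  have h1 := hb x (cavity h x) fun _ => C
  have h2 : ∑ i, ∑ j, cavity h x i * C * coupling h x i j =
      C * ((p - 1) * ∑ i, cavity h x i ^ 2) := by
    rw [Finset.mul_sum, Finset.mul_sum]
    refine Finset.sum_congr rfl fun i _ => ?_
    rw [← Finset.mul_sum, sum_coupling]
    ring
  have h3 : ∑ _j : Fin N, C ^ 2 = N * C ^ 2 := by simp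
  rw [h2, h3] at h1
  have h4 : 0 ≤ ∑ i, cavity h x i ^ 2 := Finset.sum_nonneg fun i _ => sq_nonneg _
  have h5 : (2 : ℝ) ≤ p := by exact_mod_cast hp
  have h6 : 2 * ((p - 1) * ∑ i, cavity h x i ^ 2) ≤ ∑ i, cavity h x i ^ 2 + N * C ^ 2 := by
    have : C * (2 * ((p - 1) * ∑ i, cavity h x i ^ 2)) ≤
        C * (∑ i, cavity h x i ^ 2 + N * C ^ 2) := by linarith
    exact le_of_mul_le_mul_left this hC
  nlinarith

theorem CouplingBound.sum_coupling_sq_le (hC : 0 < C) (hb : CouplingBound h C)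
    (x : Config N) (i : Fin N) : ∑ j, coupling h x i j ^ 2 ≤ C ^ 2 := by
  have h1 := hb x (Pi.single i C) (coupling h x i)
  have h2 : ∑ k, ∑ j, (Pi.single i C : Fin N → ℝ) k * coupling h x i j * coupling h x k j =
      C * ∑ j, coupling h x i j ^ 2 := by
    rw [Finset.sum_eq_single i, Finset.mul_sum]
    · refine Finset.sum_congr rfl fun j _ => ?_
      rw [Pi.single_eq_same]; ring
    · intro k _ hk
      simp [Pi.single_eq_of_ne hk]
    · simp
  have h3 : ∑ k, (Pi.single i C : Fin N → ℝ) k ^ 2 = C ^ 2 := by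
    rw [Finset.sum_eq_single i] <;> simp +contextual [Pi.single_eq_of_ne]
  rw [h2, h3] at h1
  have : C * (2 * ∑ j, coupling h x i j ^ 2) ≤ C * (C ^ 2 + ∑ j, coupling h x i j ^ 2) := by
    linarith
  linarith [le_of_mul_le_mul_left this hC]

/-- The constant in the variance bound for the score. -/
def scoreConst (C q : ℝ) : ℝ := 4 * C ^ 2 + C * (4 * C ^ 2 + 9) + 16 * q * C ^ 2 * (1 + C ^ 2)

/-- Site `i` contributes `φ(y) - φ(-y) = 2 y`. Since the coupling diagonal is zero, the remaining
sum may run over all `j`. -/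
theorem score_sub_flip (b : ℝ) (x : Config N) (i : Fin N) :
    score h b x - score h b (flip x i) = 2 * cavity h x i +
      ∑ j, (siteScore (p * b) (cavity h x j) -
        siteScore (p * b) (cavity h x j - 2 * coupling h x i j)) := by
  rw [score, score, ← Finset.sum_sub_distrib, ← Finset.add_sum_erase _ _ (Finset.mem_univ i),
    ← Finset.add_sum_erase (a := i) _ (fun j => siteScore (p * b) (cavity h x j) -
        siteScore (p * b) (cavity h x j - 2 * coupling h x i j)) (Finset.mem_univ i)]
  rw [coupling_self, mul_zero, sub_zero, sub_self, zero_add, cavity_flip_self]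
  congr 1
  · simp only [siteScore, mul_neg, Real.tanh_neg]; ring
  · refine Finset.sum_congr rfl fun j hj => ?_
    rw [cavity_flip_of_ne h x (Finset.ne_of_mem_erase hj).symm]

theorem CouplingBound.sum_siteScore_mul_score_sub_flip_le (hp : 2 ≤ p) (hC : 0 < C)
    (hb : CouplingBound h C) {b : ℝ} (hb0 : 0 ≤ b) (x : Config N) :
    ∑ i, siteScore (p * b) (cavity h x i) * (score h b x - score h b (flip x i)) ≤
      scoreConst C (p * b) * N := by
  set q : ℝ := p * b with hq
  have hq0 : 0 ≤ q := by positivity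
  have hF := hb.sum_cavity_sq_le hp hC x
  -- Three parts: the site `i` itself, the linear response of the other fields, and the Taylor
  -- remainder, which is summable because each row of the coupling matrix has square norm at most
  -- `C²`.
  have hpt : ∀ i, siteScore q (cavity h x i) * (score h b x - score h b (flip x i)) ≤
      4 * cavity h x i ^ 2 +
      2 * ∑ j, siteScore q (cavity h x i) * siteSlope q (cavity h x j) * coupling h x i j +
      16 * q * C ^ 2 * (1 + cavity h x i ^ 2) := by
    intro i
    set y := cavity h x i with hy
    have h1 : |siteScore q y| ≤ 2 * |y| := abs_siteScore_le q y
    have h2 : siteScore q y * (2 * y) ≤ 4 * y ^ 2 := by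
      calc siteScore q y * (2 * y) ≤ |siteScore q y * (2 * y)| := le_abs_self _
        _ = |siteScore q y| * (2 * |y|) := by rw [abs_mul, abs_mul, abs_two]
        _ ≤ 2 * |y| * (2 * |y|) := by gcongr
        _ = 4 * |y| ^ 2 := by ring
        _ = 4 * y ^ 2 := by rw [sq_abs]
    set R : ℝ := ∑ j, (siteScore q (cavity h x j) -
        siteScore q (cavity h x j - 2 * coupling h x i j) -
        2 * coupling h x i j * siteSlope q (cavity h x j)) with hR
    have h3 : |R| ≤ 16 * q * C ^ 2 := by
      refine (Finset.abs_sum_le_sum_abs _ _).trans ?_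
      calc _ ≤ ∑ j, 16 * q * coupling h x i j ^ 2 := by
            refine Finset.sum_le_sum fun j _ => ?_
            refine (abs_siteScore_sub_le hq0 _ _).trans (le_of_eq ?_)
            ring
        _ = 16 * q * ∑ j, coupling h x i j ^ 2 := by rw [Finset.mul_sum]
        _ ≤ _ := by gcongr; exact hb.sum_coupling_sq_le hC x i
    have h4 : siteScore q y * R ≤ 16 * q * C ^ 2 * (1 + y ^ 2) := by
      calc siteScore q y * R ≤ |siteScore q y * R| := le_abs_self _
        _ = |siteScore q y| * |R| := abs_mul _ _
        _ ≤ (2 * |y|) * (16 * q * C ^ 2) := by gcongr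
        _ = 16 * q * C ^ 2 * (2 * |y|) := by ring
        _ ≤ 16 * q * C ^ 2 * (1 + y ^ 2) := by
          gcongr
          nlinarith [sq_nonneg (|y| - 1), sq_abs y]
    have h5 : score h b x - score h b (flip x i) = 2 * y +
        ∑ j, 2 * coupling h x i j * siteSlope q (cavity h x j) + R := by
      rw [score_sub_flip, hR, ← hq, ← hy, add_assoc, ← Finset.sum_add_distrib]
      congr 1
      exact Finset.sum_congr rfl fun j _ => by ring
    have h6 : siteScore q y * ∑ j, 2 * coupling h x i j * siteSlope q (cavity h x j) =
        2 * ∑ j, siteScore q y * siteSlope q (cavity h x j) * coupling h x i j := by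
      rw [Finset.mul_sum, Finset.mul_sum]
      exact Finset.sum_congr rfl fun j _ => by ring
    rw [h5, mul_add, mul_add, h6]
    linarith
  -- The operator norm is essential here: Cauchy–Schwarz row by row would only give order `N^{3/2}`.
  have hbil := hb x (fun i => siteScore q (cavity h x i)) fun j => siteSlope q (cavity h x j)
  have hu : ∑ i, siteScore q (cavity h x i) ^ 2 ≤ 4 * ∑ i, cavity h x i ^ 2 := by
    rw [Finset.mul_sum]
    refine Finset.sum_le_sum fun i _ => ?_
    have := abs_siteScore_le q (cavity h x i)
    rw [← sq_abs, ← sq_abs (cavity h x i)]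
    nlinarith [abs_nonneg (siteScore q (cavity h x i))]
  have hv : ∑ j, siteSlope q (cavity h x j) ^ 2 ≤ 9 * N := by
    calc _ ≤ ∑ _j : Fin N, (9 : ℝ) := by
          refine Finset.sum_le_sum fun j _ => ?_
          have := abs_siteSlope_le q (cavity h x j)
          rw [← sq_abs]
          nlinarith [abs_nonneg (siteSlope q (cavity h x j))]
      _ = 9 * N := by simp [mul_comm]
  have hbil' : 2 * ∑ i, ∑ j, siteScore q (cavity h x i) * siteSlope q (cavity h x j) *
      coupling h x i j ≤ C * (4 * C ^ 2 + 9) * N := by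
    refine hbil.trans ?_
    have : ∑ i, siteScore q (cavity h x i) ^ 2 + ∑ j, siteSlope q (cavity h x j) ^ 2 ≤
      (4 * C ^ 2 + 9) * N := by linarith
    calc _ ≤ C * ((4 * C ^ 2 + 9) * N) := by gcongr
      _ = _ := by ring
  -- The three parts give the three summands of `scoreConst`.
  refine (Finset.sum_le_sum fun i _ => hpt i).trans ?_
  rw [Finset.sum_add_distrib, Finset.sum_add_distrib, ← Finset.mul_sum, ← Finset.mul_sum,
    ← Finset.mul_sum, Finset.sum_add_distrib]
  have hone : ∑ _i : Fin N, (1 : ℝ) = N := by simp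
  rw [hone, scoreConst]
  have : 16 * q * C ^ 2 * (N + ∑ i, cavity h x i ^ 2) ≤ 16 * q * C ^ 2 * (N + C ^ 2 * N) := by
    gcongr
  linarith

end Bounds

/-! ### Second moment of the score under the Gibbs measure -/

section Gibbs

variable {p N : ℕ} (h : Block p N → ℝ) (b : ℝ)

/-- The unnormalised Gibbs weight. -/
def weight (x : Config N) : ℝ := Real.exp (b * (p * energy h x))

theorem weight_flip (x : Config N) (i : Fin N) :
    weight h b (flip x i) = weight h b x * Real.exp (-2 * (p * b * cavity h x i)) := by
  rw [weight, weight, ← Real.exp_add, energy_flip]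
  congr 1
  ring

theorem sum_flip (i : Fin N) (f : Config N → ℝ) : ∑ x, f (flip x i) = ∑ x, f x :=
  Fintype.sum_equiv (Function.Involutive.toPerm (fun x => flip x i) fun x => flip_flip x i)
    _ _ fun _ => rfl

/-- Substitute `flip x i` for `x`: the change of weight turns `φ(-c_i)` into `-φ(c_i)`. -/
theorem sum_weight_mul_siteScore_mul_score_flip (i : Fin N) :
    ∑ x, weight h b x * (siteScore (p * b) (cavity h x i) * score h b (flip x i)) =
      -∑ x, weight h b x * (siteScore (p * b) (cavity h x i) * score h b x) := by
  rw [← sum_flip i, ← Finset.sum_neg_distrib]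
  refine Finset.sum_congr rfl fun x _ => ?_
  rw [flip_flip, weight_flip, cavity_flip_self]
  linear_combination weight h b x * score h b x *
    siteScore_neg_mul_exp (p * b) (cavity h x i)

variable {h b} {C : ℝ}

/-- By the flip identity, `∑ φ(c_i) (S(x) - S(x^i))` averages to twice the second moment of `S`, and
it is bounded pointwise. -/
theorem CouplingBound.sum_weight_mul_score_sq_le (hp : 2 ≤ p) (hC : 0 < C)
    (hb : CouplingBound h C) (hb0 : 0 ≤ b) :
    ∑ x, weight h b x * score h b x ^ 2 ≤ scoreConst C (p * b) * N * ∑ x, weight h b x := by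
  have h1 : ∑ x, weight h b x * ∑ i, siteScore (p * b) (cavity h x i) *
      (score h b x - score h b (flip x i)) = 2 * ∑ x, weight h b x * score h b x ^ 2 := by
    have e : ∀ x, weight h b x * score h b x ^ 2 =
        ∑ i, weight h b x * (siteScore (p * b) (cavity h x i) * score h b x) := by
      intro x
      rw [← Finset.mul_sum, ← Finset.sum_mul, ← score, sq]
    rw [Finset.sum_congr rfl fun x _ => e x]
    simp_rw [Finset.mul_sum, mul_sub, Finset.sum_sub_distrib]
    have e2 := Finset.sum_comm (s := Finset.univ) (t := Finset.univ)
      (f := fun (x : Config N) i =>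
        weight h b x * (siteScore (p * b) (cavity h x i) * score h b (flip x i)))
    have e3 := Finset.sum_comm (s := Finset.univ) (t := Finset.univ)
      (f := fun (x : Config N) i =>
        weight h b x * (siteScore (p * b) (cavity h x i) * score h b x))
    rw [e2, Finset.sum_congr rfl fun i _ => sum_weight_mul_siteScore_mul_score_flip h b i,
      Finset.sum_neg_distrib, ← e3]
    simp_rw [← Finset.mul_sum]
    ring
  have h2 : ∑ x, weight h b x * ∑ i, siteScore (p * b) (cavity h x i) *
      (score h b x - score h b (flip x i)) ≤
      ∑ x, weight h b x * (scoreConst C (p * b) * N) :=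
    Finset.sum_le_sum fun x _ => mul_le_mul_of_nonneg_left
      (hb.sum_siteScore_mul_score_sub_flip_le hp hC hb0 x) (Real.exp_pos _).le
  have h3 : 0 ≤ ∑ x, weight h b x * score h b x ^ 2 :=
    Finset.sum_nonneg fun x _ => mul_nonneg (Real.exp_pos _).le (sq_nonneg _)
  rw [h1, ← Finset.sum_mul] at h2
  linarith

theorem gibbsMass_skTensor [NeZero p] (γ : DisorderIndex p → ℝ) (x : Config N) :
    gibbsMass (skTensor p γ N) b x =
      weight (skCoupling p γ N) b x / ∑ y, weight (skCoupling p γ N) b y := by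
  rw [gibbsMass, partitionFunction]
  simp only [hamiltonian_skTensor, weight]
  have : (2 : ℝ) ^ N ≠ 0 := by positivity
  field_simp

theorem sum_weight_pos (h : Block p N → ℝ) (b : ℝ) : 0 < ∑ x, weight h b x :=
  Finset.sum_pos (fun _ _ => Real.exp_pos _) ⟨1, Finset.mem_univ _⟩

/-- Chebyshev's inequality for the score. -/
theorem gibbsProb_ge_of_score [NeZero p] {γ : DisorderIndex p → ℝ} (hp : 2 ≤ p) (hC : 0 < C)
    (hb : CouplingBound (skCoupling p γ N) C) (hb0 : 0 ≤ b) (hN : 0 < N) {L : ℝ} (hL : 0 < L)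
    {A : Set (Config N)}
    (hA : ∀ x, score (skCoupling p γ N) b x ^ 2 ≤ L * N → x ∈ A) :
    1 - scoreConst C (p * b) / L ≤ gibbsProb (skTensor p γ N) b A := by
  classical
  have hN' : (0 : ℝ) < N := by exact_mod_cast hN
  set w := weight (skCoupling p γ N) b with hw
  set Z := ∑ y, w y with hZ
  have hZ0 : 0 < Z := sum_weight_pos _ _
  have h1 : gibbsProb (skTensor p γ N) b A = (∑ x with x ∈ A, w x) / Z := by
    rw [gibbsProb, Finset.sum_div]
    refine Finset.sum_congr ?_ fun x _ => gibbsMass_skTensor γ x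
    ext; simp
  have h2 : (∑ x with x ∈ A, w x) + ∑ x with x ∉ A, w x = Z :=
    Finset.sum_filter_add_sum_filter_not _ _ _
  have h3 : L * N * ∑ x with x ∉ A, w x ≤ scoreConst C (p * b) * N * Z := by
    refine le_trans ?_ (hb.sum_weight_mul_score_sq_le hp hC hb0)
    calc L * N * ∑ x with x ∉ A, w x = ∑ x with x ∉ A, w x * (L * N) := by
          rw [Finset.mul_sum]; exact Finset.sum_congr rfl fun _ _ => mul_comm _ _
      _ ≤ ∑ x with x ∉ A, w x * score (skCoupling p γ N) b x ^ 2 := by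
          refine Finset.sum_le_sum fun x hx => ?_
          refine mul_le_mul_of_nonneg_left ?_ (Real.exp_pos _).le
          by_contra! hlt
          exact (Finset.mem_filter.1 hx).2 (hA x hlt.le)
      _ ≤ _ := Finset.sum_le_univ_sum_of_nonneg fun x =>
          mul_nonneg (Real.exp_pos _).le (sq_nonneg _)
  rw [h1, le_div_iff₀ hZ0, sub_mul, one_mul, sub_le_iff_le_add]
  have h4 : ∑ x with x ∉ A, w x ≤ scoreConst C (p * b) / L * Z := by
    rw [div_mul_eq_mul_div, le_div_iff₀ hL]
    have : N * ((∑ x with x ∉ A, w x) * L) ≤ N * (scoreConst C (p * b) * Z) := by linarith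
    exact le_of_mul_le_mul_left this hN'
  linarith

end Gibbs

/-! ### Strict decrease of the score and location of its zero -/

theorem hasDerivAt_mul_tanh (y t : ℝ) :
    HasDerivAt (fun t => y * Real.tanh (t * y)) (y ^ 2 * (1 - Real.tanh (t * y) ^ 2)) t := by
  have h := ((hasDerivAt_tanh (t * y)).comp t ((hasDerivAt_id t).mul_const y)).const_mul y
  refine h.congr_deriv ?_
  ring

theorem siteScore_antitone (y : ℝ) : Antitone fun q => siteScore q y := by
  have h : Monotone fun t => y * Real.tanh (t * y) := by
    refine monotone_of_deriv_nonneg (fun t => (hasDerivAt_mul_tanh y t).differentiableAt)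
      fun t => ?_
    rw [(hasDerivAt_mul_tanh y t).deriv]
    have := Real.tanh_sq_lt_one (t * y)
    exact mul_nonneg (sq_nonneg _) (by linarith)
  intro a b hab
  have := h hab
  simp only [siteScore] at this ⊢
  linarith

theorem le_one_sub_tanh_sq {y Y : ℝ} (h : |y| ≤ |Y|) :
    1 - Real.tanh Y ^ 2 ≤ 1 - Real.tanh y ^ 2 := by
  rw [one_sub_tanh_sq, one_sub_tanh_sq]
  have h1 := Real.cosh_le_cosh.2 h
  have h2 := Real.cosh_pos y
  gcongr

/-- Mean value inequality in the parameter: the derivative of `y tanh (t y)` is `y² / cosh² (t y)`,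
at least `ε² / cosh² (Q K)`. -/
theorem siteScore_sub_ge {ε K Q y a b : ℝ} (hε : 0 ≤ ε) (h1 : ε < |y|) (h2 : |y| ≤ K)
    (ha : 0 ≤ a) (hab : a ≤ b) (hb : b ≤ Q) :
    ε ^ 2 * (1 - Real.tanh (Q * K) ^ 2) * (b - a) ≤ siteScore a y - siteScore b y := by
  have hmv := (convex_Icc (0 : ℝ) Q).mul_sub_le_image_sub_of_le_deriv
    (f := fun t => y * Real.tanh (t * y)) (C := ε ^ 2 * (1 - Real.tanh (Q * K) ^ 2))
    (fun t _ => (hasDerivAt_mul_tanh y t).continuousAt.continuousWithinAt)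
    (fun t _ => (hasDerivAt_mul_tanh y t).differentiableAt.differentiableWithinAt)
    (fun t ht => by
      rw [interior_Icc] at ht
      rw [(hasDerivAt_mul_tanh y t).deriv]
      have hQ : 0 ≤ Q := ht.1.le.trans ht.2.le
      have e1 : ε ^ 2 ≤ y ^ 2 := by
        rw [← sq_abs y]
        gcongr
      have e2 : 1 - Real.tanh (Q * K) ^ 2 ≤ 1 - Real.tanh (t * y) ^ 2 := by
        refine le_one_sub_tanh_sq ?_
        rw [abs_mul, abs_mul, abs_of_pos ht.1, abs_of_nonneg hQ]
        have := h2.trans (le_abs_self K)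
        have := ht.2.le
        gcongr
      have e3 := Real.tanh_sq_lt_one (Q * K)
      exact mul_le_mul e1 e2 (by linarith) (sq_nonneg _))
    a ⟨ha, hab.trans hb⟩ b ⟨ha.trans hab, hb⟩ hab
  simp only [siteScore] at hmv ⊢
  linarith

/-- A positive proportion of the cavity fields is bounded and bounded away from zero. -/
def FieldsSpread {p N : ℕ} (h : Block p N → ℝ) (ε K : ℝ) : Prop :=
  ∀ x : Config N, (N : ℝ) / 14 ≤
    ((Finset.univ.filter fun i => ε < |cavity h x i| ∧ |cavity h x i| ≤ K).card : ℝ)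

/-- The rate of decrease of the score per vertex on the parameter interval `[0, B]`. -/
def slopeConst (p : ℕ) (ε K B : ℝ) : ℝ :=
  ε ^ 2 * (1 - Real.tanh (p * B * K) ^ 2) * p / 14

theorem slopeConst_pos {p : ℕ} (hp : 0 < p) {ε : ℝ} (hε : 0 < ε) (K B : ℝ) :
    0 < slopeConst p ε K B := by
  have h1 : (0 : ℝ) < p := by exact_mod_cast hp
  have h2 : 0 < 1 - Real.tanh (p * B * K) ^ 2 := by linarith [Real.tanh_sq_lt_one (p * B * K)]
  rw [slopeConst]
  positivity

section Score

variable {p N : ℕ} {h : Block p N → ℝ} {ε K : ℝ}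

theorem continuous_score (x : Config N) : Continuous fun b => score h b x := by
  refine continuous_finsetSum _ fun i _ => ?_
  have ht : Continuous Real.tanh :=
    continuous_iff_continuousAt.2 fun y => (hasDerivAt_tanh y).continuousAt
  simp only [siteScore]
  fun_prop

theorem FieldsSpread.score_sub_ge (hs : FieldsSpread h ε K) (hε : 0 ≤ ε) (x : Config N)
    {a b B : ℝ} (ha : 0 ≤ a) (hab : a ≤ b) (hb : b ≤ B) :
    slopeConst p ε K B * N * (b - a) ≤ score h a x - score h b x := by
  have h3 := Real.tanh_sq_lt_one (p * B * K)
  have hc : 0 ≤ ε ^ 2 * (1 - Real.tanh (p * B * K) ^ 2) * (p * b - p * a) := by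
    have : 0 ≤ 1 - Real.tanh (p * B * K) ^ 2 := by linarith
    have : (p : ℝ) * a ≤ p * b := by gcongr
    exact mul_nonneg (by positivity) (by linarith)
  rw [score, score, ← Finset.sum_sub_distrib]
  calc slopeConst p ε K B * N * (b - a)
      = N / 14 * (ε ^ 2 * (1 - Real.tanh (p * B * K) ^ 2) * (p * b - p * a)) := by
        rw [slopeConst]; ring
    _ ≤ ((Finset.univ.filter fun i => ε < |cavity h x i| ∧ |cavity h x i| ≤ K).card : ℝ) *
        (ε ^ 2 * (1 - Real.tanh (p * B * K) ^ 2) * (p * b - p * a)) := by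
        gcongr
        exact hs x
    _ = ∑ i with ε < |cavity h x i| ∧ |cavity h x i| ≤ K,
        ε ^ 2 * (1 - Real.tanh (p * B * K) ^ 2) * (p * b - p * a) := by
        rw [Finset.sum_const, nsmul_eq_mul]
    _ ≤ ∑ i with ε < |cavity h x i| ∧ |cavity h x i| ≤ K,
        (siteScore (p * a) (cavity h x i) - siteScore (p * b) (cavity h x i)) := by
        refine Finset.sum_le_sum fun i hi => ?_
        obtain ⟨h1, h2⟩ := (Finset.mem_filter.1 hi).2
        exact siteScore_sub_ge hε h1 h2 (by positivity) (by gcongr) (by gcongr)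
    -- The other sites also decrease and can only help.
    _ ≤ _ := by
        refine Finset.sum_le_univ_sum_of_nonneg fun i => sub_nonneg.2 ?_
        exact siteScore_antitone _ (by gcongr)

/-- A small score at `β` forces the maximum pseudolikelihood estimate to be close to `β`. -/
theorem FieldsSpread.abs_mple_sub_le [NeZero p] {γ : DisorderIndex p → ℝ}
    (hs : FieldsSpread (skCoupling p γ N) ε K) (hε : 0 < ε) {β L : ℝ} (hL : 0 ≤ L)
    (hN : 0 < N) (hlarge : √L / slopeConst p ε K (2 * β) / √N ≤ β) {x : Config N}
    (hx : score (skCoupling p γ N) β x ^ 2 ≤ L * N) :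
    ENNReal.ofReal √N * (mple (skTensor p γ N) x - (β : EReal)).abs ≤
      ENNReal.ofReal (√L / slopeConst p ε K (2 * β)) := by
  set κ := slopeConst p ε K (2 * β) with hκ
  have hκ0 : 0 < κ := slopeConst_pos (Nat.pos_of_ne_zero (NeZero.ne p)) hε _ _
  have hN' : (0 : ℝ) < N := by exact_mod_cast hN
  have hsN : 0 < √(N : ℝ) := Real.sqrt_pos.2 hN'
  set r := √L / κ / √N with hr
  have hr0 : 0 ≤ r := by positivity
  set S := fun b => score (skCoupling p γ N) b x with hS
  -- The radius `r` is chosen so that the guaranteed drop `κ N r` equals `√(L N)`; `hlarge` keeps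
  -- `[β - r, β + r]` inside `[0, 2β]`.
  have habs : |S β| ≤ κ * N * r := by
    have e : κ * N * r = √(L * N) := by
      rw [hr, Real.sqrt_mul hL]
      field_simp
      rw [Real.sq_sqrt hN'.le, mul_comm]
    rw [e]
    exact Real.abs_le_sqrt hx
  obtain ⟨hlo, hhi⟩ := abs_le.1 habs
  have h1 : 0 ≤ S (β - r) := by
    have := hs.score_sub_ge hε.le x (a := β - r) (b := β) (B := 2 * β) (by linarith)
      (by linarith) (by linarith)
    rw [← hκ, sub_sub_cancel] at this
    simp only [hS] at hlo ⊢
    linarith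
  have h2 : S (β + r) ≤ 0 := by
    have := hs.score_sub_ge hε.le x (a := β) (b := β + r) (B := 2 * β) (by linarith)
      (by linarith) (by linarith)
    rw [← hκ, add_sub_cancel_left] at this
    simp only [hS] at hhi ⊢
    linarith
  obtain ⟨c, hc, hc0⟩ : (0 : ℝ) ∈ S '' Set.Icc (β - r) (β + r) :=
    intermediate_value_Icc' (by linarith) (continuous_score x).continuousOn ⟨h2, h1⟩
  have hle : mple (skTensor p γ N) x ≤ ((β + r : ℝ) : EReal) := by
    have hmem : mple (skTensor p γ N) x ≤ (c : EReal) :=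
      sInf_le ⟨c, rfl, by linarith [hc.1], (pseudolikelihood_equation_iff γ x c).2 hc0⟩
    exact hmem.trans (EReal.coe_le_coe_iff.2 hc.2)
  -- Strict decrease excludes every root in `[0, β - r)`, as the infimum requires.
  have hge : ((β - r : ℝ) : EReal) ≤ mple (skTensor p γ N) x := by
    refine le_sInf ?_
    rintro _ ⟨c', rfl, hc'0, hc'⟩
    rw [pseudolikelihood_equation_iff] at hc'
    refine EReal.coe_le_coe_iff.2 ?_
    by_contra! hlt
    have := hs.score_sub_ge hε.le x (a := c') (b := β - r) (B := 2 * β) hc'0 hlt.le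
      (by linarith)
    rw [← hκ, hc'] at this
    simp only [hS] at h1
    have : 0 < κ * N * (β - r - c') := mul_pos (by positivity) (by linarith)
    linarith
  obtain ⟨m, hm⟩ : ∃ m : ℝ, mple (skTensor p γ N) x = m := by
    induction hq : mple (skTensor p γ N) x with
    | bot => rw [hq] at hge; exact absurd (le_bot_iff.1 hge) (EReal.coe_ne_bot _)
    | top => rw [hq] at hle; exact absurd (top_le_iff.1 hle) (EReal.coe_ne_top _)
    | coe m => exact ⟨m, rfl⟩
  rw [hm, EReal.coe_le_coe_iff] at hle hge
  rw [hm, ← EReal.coe_sub, EReal.abs_def, ← ENNReal.ofReal_mul (Real.sqrt_nonneg _)]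
  refine ENNReal.ofReal_le_ofReal ?_
  have hmr : |m - β| ≤ r := abs_le.2 ⟨by linarith, by linarith⟩
  calc √(N : ℝ) * |m - β| ≤ √N * r := by gcongr
    _ = √L / κ := by rw [hr]; field_simp

end Score

/-! ### Bilinear forms tested on integer vectors -/

section Rounding

theorem sum_two_pow_neg_natAbs_le (n : ℕ) :
    ∑ k ∈ Finset.Icc (-(n : ℤ)) n, (1 / 2 : ℝ) ^ k.natAbs ≤ 3 - 2 * (1 / 2) ^ n := by
  induction n with
  | zero => simp; norm_num
  | succ n ih =>
    have e : Finset.Icc (-((n + 1 : ℕ) : ℤ)) ((n + 1 : ℕ) : ℤ) =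
        insert ((n + 1 : ℕ) : ℤ) (insert (-((n + 1 : ℕ) : ℤ)) (Finset.Icc (-(n : ℤ)) n)) := by
      ext k
      simp only [Finset.mem_Icc, Finset.mem_insert]
      omega
    rw [e, Finset.sum_insert (by simp only [Finset.mem_Icc, Finset.mem_insert]; omega),
      Finset.sum_insert (by simp only [Finset.mem_Icc]; omega), Int.natAbs_neg,
      Int.natAbs_natCast, pow_succ]
    linarith

/-- The integer vectors of squared norm at most `7 N`. -/
def latticeBall (N : ℕ) : Finset (Fin N → ℤ) :=
  (Fintype.piFinset fun _ => Finset.Icc (-((7 * N : ℕ) : ℤ)) ((7 * N : ℕ) : ℤ)).filter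
    fun z => ∑ i, z i ^ 2 ≤ 7 * N

theorem mem_latticeBall {N : ℕ} {z : Fin N → ℤ} :
    z ∈ latticeBall N ↔ ∑ i, z i ^ 2 ≤ 7 * N := by
  rw [latticeBall, Finset.mem_filter, and_iff_right_iff_imp, Fintype.mem_piFinset]
  intro hz i
  have h1 : z i ^ 2 ≤ 7 * N :=
    (Finset.single_le_sum (f := fun i => z i ^ 2) (fun j _ => sq_nonneg (z j))
      (Finset.mem_univ i)).trans hz
  rw [Finset.mem_Icc]
  push_cast
  constructor <;> nlinarith

/-- Exponential counting: `∑ |z_i| ≤ ∑ z_i² ≤ 7 N`, so each point has weight at least `1` under `2 ^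
(7 N) ∏ 2 ^ (-|z_i|)`, whose total is at most `(128 · 3) ^ N`. -/
theorem card_latticeBall_le (N : ℕ) : ((latticeBall N).card : ℝ) ≤ 384 ^ N := by
  have h1 : ∀ z ∈ latticeBall N, (1 : ℝ) ≤ 2 ^ (7 * N) * ∏ i, (1 / 2 : ℝ) ^ (z i).natAbs := by
    intro z hz
    rw [Finset.prod_pow_eq_pow_sum, one_div, inv_pow, ← div_eq_mul_inv, one_le_div (by positivity)]
    refine pow_le_pow_right₀ (by norm_num) ?_
    have h2 : ∑ i, ((z i).natAbs : ℤ) ≤ ∑ i, z i ^ 2 := by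
      refine Finset.sum_le_sum fun i _ => ?_
      rw [← Int.natAbs_sq (z i)]
      exact_mod_cast Nat.le_self_pow (by norm_num) _
    have h3 := h2.trans (mem_latticeBall.1 hz)
    exact_mod_cast h3
  calc ((latticeBall N).card : ℝ) = ∑ z ∈ latticeBall N, 1 := by simp
    _ ≤ ∑ z ∈ latticeBall N, 2 ^ (7 * N) * ∏ i, (1 / 2 : ℝ) ^ (z i).natAbs :=
        Finset.sum_le_sum h1
    _ ≤ ∑ z ∈ Fintype.piFinset fun _ : Fin N =>
          Finset.Icc (-((7 * N : ℕ) : ℤ)) ((7 * N : ℕ) : ℤ),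
          2 ^ (7 * N) * ∏ i, (1 / 2 : ℝ) ^ (z i).natAbs :=
        Finset.sum_le_sum_of_subset_of_nonneg (Finset.filter_subset _ _)
          fun _ _ _ => by positivity
    _ = 2 ^ (7 * N) * (∑ k ∈ Finset.Icc (-((7 * N : ℕ) : ℤ)) ((7 * N : ℕ) : ℤ),
          (1 / 2 : ℝ) ^ k.natAbs) ^ N := by
        rw [← Finset.mul_sum, Finset.sum_prod_piFinset _ fun _ (k : ℤ) => (1 / 2 : ℝ) ^ k.natAbs]
        simp
    _ ≤ 2 ^ (7 * N) * 3 ^ N := by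
        gcongr
        have := sum_two_pow_neg_natAbs_le (7 * N)
        have : (0 : ℝ) < (1 / 2) ^ (7 * N) := by positivity
        linarith
    _ = 384 ^ N := by rw [pow_mul, ← mul_pow]; norm_num

variable {N : ℕ} (G : Fin N → Fin N → ℝ)

/-- The bilinear form of a square array. -/
def bilin (u v : Fin N → ℝ) : ℝ := ∑ i, ∑ j, u i * v j * G i j

theorem bilin_add_left (u u' v : Fin N → ℝ) :
    bilin G (u + u') v = bilin G u v + bilin G u' v := by
  simp only [bilin, ← Finset.sum_add_distrib, Pi.add_apply, add_mul]

theorem bilin_add_right (u v v' : Fin N → ℝ) :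
    bilin G u (v + v') = bilin G u v + bilin G u v' := by
  simp only [bilin, ← Finset.sum_add_distrib, Pi.add_apply, mul_add, add_mul]

theorem bilin_smul_smul (a b : ℝ) (u v : Fin N → ℝ) :
    bilin G (a • u) (b • v) = a * b * bilin G u v := by
  simp only [bilin, Finset.mul_sum, Pi.smul_apply, smul_eq_mul]
  exact Finset.sum_congr rfl fun i _ => Finset.sum_congr rfl fun j _ => by ring

theorem bilin_le_of_forall_le {m R : ℝ}
    (hm : ∀ u v : Fin N → ℝ, ∑ i, u i ^ 2 ≤ R → ∑ i, v i ^ 2 ≤ R → bilin G u v ≤ m)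
    {a b : ℝ} (ha : 0 < a) (hb : 0 < b) {u v : Fin N → ℝ}
    (hu : ∑ i, u i ^ 2 ≤ a ^ 2 * R) (hv : ∑ i, v i ^ 2 ≤ b ^ 2 * R) :
    bilin G u v ≤ a * b * m := by
  have key : ∀ {c : ℝ} {w : Fin N → ℝ}, 0 < c → ∑ i, w i ^ 2 ≤ c ^ 2 * R →
      ∑ i, (c⁻¹ • w) i ^ 2 ≤ R := by
    intro c w hc hw
    simp only [Pi.smul_apply, smul_eq_mul, mul_pow, ← Finset.mul_sum]
    rw [inv_pow, inv_mul_le_iff₀ (by positivity)]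
    exact hw
  have h := hm _ _ (key ha hu) (key hb hv)
  rw [bilin_smul_smul] at h
  calc bilin G u v = a * b * (a⁻¹ * b⁻¹ * bilin G u v) := by field_simp
    _ ≤ a * b * m := by gcongr

theorem sum_sq_round_le {u : Fin N → ℝ} (hu : ∑ i, u i ^ 2 ≤ 4 * N) :
    ∑ i, ((round (u i) : ℤ) : ℝ) ^ 2 ≤ (5 / 4) ^ 2 * (4 * N) ∧
      ∑ i, (u i - round (u i)) ^ 2 ≤ (1 / 4) ^ 2 * (4 * N) := by
  have hr : ∀ i, (u i - round (u i)) ^ 2 ≤ 1 / 4 := fun i => by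
    have := abs_le.1 (abs_sub_round (u i))
    nlinarith
  have h2 : ∑ i, (u i - round (u i)) ^ 2 ≤ (1 / 4) ^ 2 * (4 * N) := by
    refine (Finset.sum_le_sum fun i _ => hr i).trans (le_of_eq ?_)
    simp; ring
  refine ⟨?_, h2⟩
  have h1 : ∀ i, ((round (u i) : ℤ) : ℝ) ^ 2 ≤ 5 / 4 * u i ^ 2 + 5 * (u i - round (u i)) ^ 2 :=
    fun i => by
      -- The weights `5/4` and `5` make the sum exactly `25 N / 4`, below the `7 N` of
      -- `latticeBall`.
      have := sq_nonneg (u i / 2 + 2 * (u i - (round (u i) : ℝ)))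
      linarith
  calc _ ≤ ∑ i, (5 / 4 * u i ^ 2 + 5 * (u i - round (u i)) ^ 2) :=
        Finset.sum_le_sum fun i _ => h1 i
    _ = 5 / 4 * ∑ i, u i ^ 2 + 5 * ∑ i, (u i - round (u i)) ^ 2 := by
        rw [Finset.sum_add_distrib, ← Finset.mul_sum, ← Finset.mul_sum]
    _ ≤ _ := by linarith

/-- Round a maximising pair on the ball of squared radius `4 N`. The rounding errors cost only a
fraction of the maximum, which is absorbed; scaling then covers all vectors. -/
theorem bilin_le_of_lattice (hN : 0 < N) {C : ℝ} (hC : 0 ≤ C)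
    (hl : ∀ z ∈ latticeBall N, ∀ z' ∈ latticeBall N,
      bilin G (fun i => z i) (fun i => z' i) ≤ C * N) (u v : Fin N → ℝ) :
    2 * bilin G u v ≤ C * (∑ i, u i ^ 2 + ∑ i, v i ^ 2) := by
  have hN' : (0 : ℝ) < N := by exact_mod_cast hN
  set D : Set (Fin N → ℝ) := {u | ∑ i, u i ^ 2 ≤ 4 * N} with hD
  have hcl : IsClosed D := isClosed_le (by fun_prop) continuous_const
  have hbd : Bornology.IsBounded D := by
    refine (Metric.isBounded_closedBall (x := (0 : Fin N → ℝ)) (r := √(4 * N))).subset ?_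
    intro u hu
    rw [mem_closedBall_zero_iff, pi_norm_le_iff_of_nonneg (Real.sqrt_nonneg _)]
    intro i
    refine Real.abs_le_sqrt (le_trans ?_ hu)
    exact Finset.single_le_sum (f := fun i => u i ^ 2) (fun j _ => sq_nonneg (u j))
      (Finset.mem_univ i)
  have hDc : IsCompact D := Metric.isCompact_of_isClosed_isBounded hcl hbd
  have hD0 : (0 : Fin N → ℝ) ∈ D := by simp [hD]
  have hcont : Continuous fun w : (Fin N → ℝ) × (Fin N → ℝ) => bilin G w.1 w.2 := by
    unfold bilin; fun_prop
  obtain ⟨⟨u0, v0⟩, ⟨hu0, hv0⟩, hmax⟩ := (hDc.prod hDc).exists_isMaxOn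
    ⟨(0, 0), hD0, hD0⟩ hcont.continuousOn
  set m := bilin G u0 v0 with hm
  have hm' : ∀ u v : Fin N → ℝ, ∑ i, u i ^ 2 ≤ 4 * N → ∑ i, v i ^ 2 ≤ 4 * N →
      bilin G u v ≤ m := fun u v hu hv => hmax (a := (u, v)) ⟨hu, hv⟩
  have hR : (0 : ℝ) < 4 * N := by positivity
  have hm3 : m ≤ 3 * (C * N) := by
    have hm0 : 0 ≤ m := by
      have := hm' 0 0 hD0 hD0
      simpa [bilin] using this
    obtain ⟨a1, a2⟩ := sum_sq_round_le hu0
    obtain ⟨b1, b2⟩ := sum_sq_round_le hv0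
    have hmem : ∀ w : Fin N → ℝ, ∑ i, ((round (w i) : ℤ) : ℝ) ^ 2 ≤ (5 / 4) ^ 2 * (4 * N) →
        (fun i => round (w i)) ∈ latticeBall N := fun w hw => by
      rw [mem_latticeBall]
      have : ∑ i, ((round (w i) : ℤ) : ℝ) ^ 2 ≤ 7 * N := by linarith
      exact_mod_cast this
    have e1 := hl _ (hmem u0 a1) _ (hmem v0 b1)
    have e2 := bilin_le_of_forall_le G hm' (a := 5 / 4) (b := 1 / 4) (by norm_num)
      (by norm_num) (u := fun i => ((round (u0 i) : ℤ) : ℝ))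
      (v := fun i => v0 i - round (v0 i)) a1 b2
    have e3 := bilin_le_of_forall_le G hm' (a := 1 / 4) (b := 1) (by norm_num)
      (by norm_num) (u := fun i => u0 i - round (u0 i)) (v := v0) a2 (by rw [one_pow, one_mul]; exact hv0)
    -- The error terms total `5/16 + 1/4 = 9/16` of `m`, whence `m ≤ (16/7) C N`.
    have e4 : m = bilin G (fun i => ((round (u0 i) : ℤ) : ℝ)) (fun i => ((round (v0 i) : ℤ) : ℝ)) +
        bilin G (fun i => ((round (u0 i) : ℤ) : ℝ)) (fun i => v0 i - round (v0 i)) +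
        bilin G (fun i => u0 i - round (u0 i)) v0 := by
      rw [← bilin_add_right, hm]
      have : ((fun i => ((round (v0 i) : ℤ) : ℝ)) + fun i => v0 i - round (v0 i)) = v0 := by
        ext i; simp
      rw [this, ← bilin_add_left]
      congr 1
      ext i; simp
    linarith
  have hz : ∀ w : Fin N → ℝ, ∑ i, w i ^ 2 ≤ 0 → w = 0 := fun w hw => by
    have h0 := (Finset.sum_eq_zero_iff_of_nonneg fun i _ => sq_nonneg (w i)).1
      (le_antisymm hw (Finset.sum_nonneg fun i _ => sq_nonneg (w i)))
    ext i
    exact pow_eq_zero_iff (two_ne_zero) |>.1 (h0 i (Finset.mem_univ i))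
  set α := ∑ i, u i ^ 2 with hα
  set β := ∑ i, v i ^ 2 with hβ
  have hα0 : 0 ≤ α := Finset.sum_nonneg fun i _ => sq_nonneg (u i)
  have hβ0 : 0 ≤ β := Finset.sum_nonneg fun i _ => sq_nonneg (v i)
  rcases hα0.eq_or_lt with h | h
  · have : bilin G u v = 0 := by rw [hz u (hα ▸ h.symm.le)]; simp [bilin]
    rw [this, mul_zero]; positivity
  rcases hβ0.eq_or_lt with h' | h'
  · have : bilin G u v = 0 := by rw [hz v (hβ ▸ h'.symm.le)]; simp [bilin]
    rw [this, mul_zero]; positivity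
  have hs := bilin_le_of_forall_le G hm' (a := √(α / (4 * N))) (b := √(β / (4 * N)))
    (by positivity) (by positivity) (u := u) (v := v)
    (by rw [Real.sq_sqrt (by positivity), div_mul_cancel₀ _ hR.ne'])
    (by rw [Real.sq_sqrt (by positivity), div_mul_cancel₀ _ hR.ne'])
  have hab : 2 * (√(α / (4 * N)) * √(β / (4 * N))) ≤ (α + β) / (4 * N) := by
    have := two_mul_le_add_sq (√(α / (4 * N))) (√(β / (4 * N)))
    rw [Real.sq_sqrt (by positivity), Real.sq_sqrt (by positivity)] at this
    rw [add_div]; linarith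
  have hab0 : 0 ≤ √(α / (4 * N)) * √(β / (4 * N)) := by positivity
  calc 2 * bilin G u v ≤ 2 * (√(α / (4 * N)) * √(β / (4 * N)) * (3 * (C * N))) := by
        have : √(α / (4 * N)) * √(β / (4 * N)) * m ≤
          √(α / (4 * N)) * √(β / (4 * N)) * (3 * (C * N)) := by gcongr
        linarith
    _ = 2 * (√(α / (4 * N)) * √(β / (4 * N))) * (3 * (C * N)) := by ring
    _ ≤ (α + β) / (4 * N) * (3 * (C * N)) := by gcongr
    _ = 3 / 4 * (C * (α + β)) := by field_simp
    _ ≤ C * (α + β) := by nlinarith [mul_nonneg hC (add_nonneg hα0 hβ0)]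

end Rounding

/-! ### Gaussian tail and small ball estimates -/

section Gaussian

open scoped ENNReal

/-- The law of a finite family of independent standard Gaussian variables. -/
def stdGaussian (ι : Type*) [Fintype ι] : Measure (ι → ℝ) :=
  Measure.pi fun _ => gaussianReal 0 1

variable {ι : Type*} [Fintype ι]

instance : IsProbabilityMeasure (stdGaussian ι) := by unfold stdGaussian; infer_instance

theorem iIndepFun_eval_stdGaussian : iIndepFun (fun (s : ι) (y : ι → ℝ) => y s) (stdGaussian ι) :=
  iIndepFun_pi (X := fun _ => id) fun _ => aemeasurable_id

theorem hasLaw_sum_stdGaussian (c : ι → ℝ) (T : Finset ι) :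
    HasLaw (fun y : ι → ℝ => ∑ s ∈ T, c s * y s)
      (gaussianReal 0 (∑ s ∈ T, (c s ^ 2).toNNReal)) (stdGaussian ι) := by
  classical
  induction T using Finset.induction_on with
  | empty =>
    refine ⟨Measurable.aemeasurable (by fun_prop), ?_⟩
    simp [Measure.map_const]
  | insert s T hs ih =>
    refine ⟨Measurable.aemeasurable (by fun_prop), ?_⟩
    have hi : iIndepFun (fun (s : ι) (y : ι → ℝ) => c s * y s) (stdGaussian ι) :=
      iIndepFun_eval_stdGaussian.comp (fun s t => c s * t) fun s => by fun_prop
    have hind := (hi.indepFun_finsetSum_of_notMem (fun s => by fun_prop) hs).symm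
    have h1 : HasLaw (fun y : ι → ℝ => y s) (gaussianReal 0 1) (stdGaussian ι) :=
      (measurePreserving_eval (fun _ : ι => gaussianReal 0 1) s).hasLaw
    have h2 := (gaussianReal_const_mul h1 (c s)).map_eq
    have h3 := gaussianReal_add_gaussianReal_of_indepFun hind h2
      (by rw [← ih.map_eq]; congr 1; ext y; simp)
    rw [Finset.sum_insert hs, Real.toNNReal_of_nonneg (sq_nonneg (c s))]
    rw [mul_zero, add_zero, mul_one] at h3
    rw [← h3]
    congr 1
    ext y
    simp [Finset.sum_insert hs]

/-- Chernoff bound with parameter `1`, sufficient because variance and threshold will both be of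
order `N`. -/
theorem stdGaussian_sum_ge_le (c : ι → ℝ) {v : ℝ} (hv : ∑ s, c s ^ 2 ≤ v) (t : ℝ) :
    stdGaussian ι {y | t ≤ ∑ s, c s * y s} ≤ ENNReal.ofReal (Real.exp (v / 2 - t)) := by
  have hl := hasLaw_sum_stdGaussian c Finset.univ
  have hmgf := mgf_gaussianReal hl.map_eq 1
  have hint : Integrable (fun y : ι → ℝ => Real.exp (1 * ∑ s, c s * y s)) (stdGaussian ι) := by
    have := integrable_exp_mul_gaussianReal (μ := 0)
      (v := ∑ s : ι, (c s ^ 2).toNNReal) 1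
    rw [← hl.map_eq] at this
    exact this.comp_aemeasurable hl.aemeasurable
  have h := measure_ge_le_exp_mul_mgf t (zero_le_one) hint
  rw [hmgf, ← Real.exp_add] at h
  rw [← ENNReal.ofReal_toReal (measure_ne_top (stdGaussian ι) _)]
  refine ENNReal.ofReal_le_ofReal (h.trans ?_)
  refine Real.exp_le_exp.2 ?_
  have e : ((∑ s, (c s ^ 2).toNNReal : NNReal) : ℝ) = ∑ s, c s ^ 2 := by
    push_cast
    exact Finset.sum_congr rfl fun s _ => Real.coe_toNNReal _ (sq_nonneg _)
  rw [e]
  linarith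

theorem gaussianReal_abs_add_le {v : NNReal} {σ : ℝ} (hσ : 0 < σ) (hv : σ ^ 2 ≤ v) {ε : ℝ}
    (w : ℝ) :
    gaussianReal 0 v {u | |u + w| ≤ ε} ≤ ENNReal.ofReal (ε / σ) := by
  have hv0 : (0 : ℝ) < v := lt_of_lt_of_le (by positivity) hv
  have hv1 : v ≠ 0 := by
    rintro rfl
    simp at hv0
  have hset : {u : ℝ | |u + w| ≤ ε} = Set.Icc (-ε - w) (ε - w) := by
    ext u
    simp only [Set.mem_ofPred_eq, abs_le, Set.mem_Icc]
    constructor <;> rintro ⟨h1, h2⟩ <;> constructor <;> linarith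
  have hpdf : ∀ u, gaussianPDF 0 v u ≤ ENNReal.ofReal (1 / (2 * σ)) := by
    intro u
    refine ENNReal.ofReal_le_ofReal ?_
    rw [gaussianPDFReal]
    have h1 : Real.exp (-(u - 0) ^ 2 / (2 * v)) ≤ 1 := by
      rw [Real.exp_le_one_iff]
      exact div_nonpos_of_nonpos_of_nonneg (by nlinarith [sq_nonneg (u - 0)]) (by positivity)
    have h2 : 2 * σ ≤ √(2 * Real.pi * v) := by
      refine Real.le_sqrt_of_sq_le ?_
      nlinarith [Real.pi_gt_three]
    have h3 : (√(2 * Real.pi * v))⁻¹ ≤ 1 / (2 * σ) := by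
      rw [one_div]
      gcongr
    calc _ ≤ (√(2 * Real.pi * v))⁻¹ * 1 := by gcongr
      _ ≤ _ := by rw [mul_one]; exact h3
  rw [gaussianReal_apply 0 hv1, hset]
  calc ∫⁻ u in Set.Icc (-ε - w) (ε - w), gaussianPDF 0 v u
      ≤ ∫⁻ _u in Set.Icc (-ε - w) (ε - w), ENNReal.ofReal (1 / (2 * σ)) :=
        lintegral_mono fun u => hpdf u
    _ = ENNReal.ofReal (1 / (2 * σ)) * ENNReal.ofReal (ε - w - (-ε - w)) := by
        rw [setLIntegral_const, Real.volume_Icc]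
    _ = ENNReal.ofReal (ε / σ) := by
        rw [← ENNReal.ofReal_mul (by positivity)]
        congr 1
        field_simp
        ring

/-- The weight `1` on `[-ε, ε]` and `a` outside. -/
def smallWeight (ε : ℝ) (a : ℝ≥0∞) (t : ℝ) : ℝ≥0∞ := if |t| ≤ ε then 1 else a

theorem measurable_smallWeight (ε : ℝ) (a : ℝ≥0∞) : Measurable (smallWeight ε a) :=
  Measurable.ite (measurableSet_le (by fun_prop) measurable_const) measurable_const
    measurable_const

theorem lintegral_smallWeight_add_le {v : NNReal} {σ : ℝ} (hσ : 0 < σ) (hv : σ ^ 2 ≤ v) {ε : ℝ}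
    (a : ℝ≥0∞) (w : ℝ) :
    ∫⁻ u, smallWeight ε a (u + w) ∂gaussianReal 0 v ≤ a + ENNReal.ofReal (ε / σ) := by
  have hm : MeasurableSet {u : ℝ | |u + w| ≤ ε} :=
    measurableSet_le (by fun_prop) measurable_const
  calc ∫⁻ u, smallWeight ε a (u + w) ∂gaussianReal 0 v
      ≤ ∫⁻ u, (a + {u : ℝ | |u + w| ≤ ε}.indicator 1 u) ∂gaussianReal 0 v := by
        refine lintegral_mono fun u => ?_
        by_cases h : |u + w| ≤ ε <;> simp [smallWeight, h]
    _ = a + gaussianReal 0 v {u | |u + w| ≤ ε} := by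
        rw [lintegral_add_left measurable_const, lintegral_indicator_one hm]
        simp
    _ ≤ _ := by gcongr; exact gaussianReal_abs_add_le hσ hv w

/-- Linear forms `M i`, each of which has a block of variables that it does not share with the
others, satisfy a joint small ball estimate. -/
theorem lintegral_prod_smallWeight_le {κ : Type*} (M : κ → ι → ℝ) (T : κ → Finset ι) {σ : ℝ}
    (hσ : 0 < σ) {ε : ℝ} (a : ℝ≥0∞) (B : Finset κ)
    (hT : ∀ i ∈ B, σ ^ 2 ≤ ∑ s ∈ T i, M i s ^ 2)
    (hdisj : ∀ i ∈ B, ∀ j ∈ B, i ≠ j → ∀ s ∈ T i, M j s = 0) :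
    ∫⁻ y, ∏ i ∈ B, smallWeight ε a (∑ s, M i s * y s) ∂stdGaussian ι ≤
      (a + ENNReal.ofReal (ε / σ)) ^ B.card := by
  classical
  induction B using Finset.induction_on with
  | empty => simp
  | insert i B hi ih =>
    have ih' := ih (fun j hj => hT j (Finset.mem_insert_of_mem hj))
      fun j hj k hk => hdisj j (Finset.mem_insert_of_mem hj) k (Finset.mem_insert_of_mem hk)
    set U : (ι → ℝ) → ℝ := fun y => ∑ s ∈ T i, M i s * y s with hU
    set W : (ι → ℝ) → ℝ × ℝ≥0∞ := fun y =>
      (∑ s ∈ (T i)ᶜ, M i s * y s, ∏ j ∈ B, smallWeight ε a (∑ s, M j s * y s)) with hW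
    -- The other forms vanish on the block `T i`, so both they and the rest of form `i` depend only
    -- on variables outside it.
    have hind : IndepFun U W (stdGaussian ι) := by
      have h := iIndepFun_eval_stdGaussian.indepFun_finset (T i) (T i)ᶜ disjoint_compl_right
        fun s => measurable_pi_apply s
      have h' := h.comp (φ := fun r : T i → ℝ => ∑ s : T i, M i s * r s)
        (ψ := fun r : ((T i)ᶜ : Finset ι) → ℝ =>
          (∑ s : ((T i)ᶜ : Finset ι), M i s * r s,
            ∏ j ∈ B, smallWeight ε a (∑ s : ((T i)ᶜ : Finset ι), M j s * r s)))
        (by fun_prop)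
        ((by fun_prop : Measurable _).prodMk (Finset.measurable_prod _ fun j _ =>
          (measurable_smallWeight ε a).comp (by fun_prop)))
      have e1 : U = (fun r : T i → ℝ => ∑ s : T i, M i s * r s) ∘ fun y s => y s := by
        ext y
        exact (Finset.sum_coe_sort (T i) fun s => M i s * y s).symm
      have e2 : W = (fun r : ((T i)ᶜ : Finset ι) → ℝ =>
          (∑ s : ((T i)ᶜ : Finset ι), M i s * r s,
            ∏ j ∈ B, smallWeight ε a (∑ s : ((T i)ᶜ : Finset ι), M j s * r s))) ∘ fun y s => y s := by
        ext1 y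
        refine Prod.ext ?_ ?_
        · exact (Finset.sum_coe_sort (T i)ᶜ fun s => M i s * y s).symm
        · refine Finset.prod_congr rfl fun j hj => ?_
          congr 1
          rw [← Finset.sum_add_sum_compl (T i), Finset.sum_eq_zero, zero_add]
          · exact (Finset.sum_coe_sort (T i)ᶜ fun s => M j s * y s).symm
          · intro s hs
            rw [hdisj i (Finset.mem_insert_self _ _) j (Finset.mem_insert_of_mem hj)
              (fun h => hi (h ▸ hj)) s hs, zero_mul]
      rw [e1, e2]
      exact h'
    have hUm : Measurable U := by fun_prop
    have hWm : Measurable W := by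
      refine Measurable.prodMk (by fun_prop) (Finset.measurable_prod _ fun j _ =>
          (measurable_smallWeight ε a).comp (by fun_prop))
    have hlaw := (indepFun_iff_map_prod_eq_prod_map_map hUm.aemeasurable
      hWm.aemeasurable).1 hind
    set f : ℝ × (ℝ × ℝ≥0∞) → ℝ≥0∞ := fun q => smallWeight ε a (q.1 + q.2.1) * q.2.2 with hf
    have hfm : Measurable f :=
      ((measurable_smallWeight ε a).comp (by fun_prop)).mul (by fun_prop)
    have hσv : σ ^ 2 ≤ ((∑ s ∈ T i, (M i s ^ 2).toNNReal : NNReal) : ℝ) := by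
      refine (hT i (Finset.mem_insert_self _ _)).trans (le_of_eq ?_)
      push_cast
      exact Finset.sum_congr rfl fun s _ => (Real.coe_toNNReal _ (sq_nonneg _)).symm
    calc ∫⁻ y, ∏ i ∈ insert i B, smallWeight ε a (∑ s, M i s * y s) ∂stdGaussian ι
        = ∫⁻ y, f (U y, W y) ∂stdGaussian ι := by
          refine lintegral_congr fun y => ?_
          rw [Finset.prod_insert hi, ← Finset.sum_add_sum_compl (T i)]
      _ = ∫⁻ q, f q ∂((stdGaussian ι).map U).prod ((stdGaussian ι).map W) := by
          rw [← hlaw, lintegral_map hfm (hUm.prodMk hWm)]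
      _ = ∫⁻ w, ∫⁻ u, f (u, w) ∂((stdGaussian ι).map U) ∂((stdGaussian ι).map W) := by
          have := Measure.isProbabilityMeasure_map (μ := stdGaussian ι) hUm.aemeasurable
          have := Measure.isProbabilityMeasure_map (μ := stdGaussian ι) hWm.aemeasurable
          exact lintegral_prod_symm' _ hfm
      -- Given `w`, form `i` is a Gaussian shifted by a constant, and the small ball bound is
      -- uniform in the shift.
      _ ≤ ∫⁻ w, (a + ENNReal.ofReal (ε / σ)) * w.2 ∂((stdGaussian ι).map W) := by
          refine lintegral_mono fun w => ?_
          rw [(hasLaw_sum_stdGaussian (M i) (T i)).map_eq]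
          simp only [hf]
          rw [lintegral_mul_const w.2 (f := fun u => smallWeight ε a (u + w.1))
            ((measurable_smallWeight ε a).comp (by fun_prop))]
          gcongr
          exact lintegral_smallWeight_add_le hσ hσv a w.1
      _ = (a + ENNReal.ofReal (ε / σ)) *
          ∫⁻ y, ∏ i ∈ B, smallWeight ε a (∑ s, M i s * y s) ∂stdGaussian ι := by
          rw [lintegral_const_mul _ measurable_snd, lintegral_map measurable_snd hWm]
      _ ≤ (a + ENNReal.ofReal (ε / σ)) * (a + ENNReal.ofReal (ε / σ)) ^ B.card := by gcongr
      _ = _ := by rw [Finset.card_insert_of_notMem hi, pow_succ']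

end Gaussian

/-! ### Operator norm of the coupling matrices -/

section Disorder

open scoped ENNReal

variable {p N : ℕ}

/-- The normalisation of the couplings in the Sherrington-Kirkpatrick model. -/
def skScale (p N : ℕ) : ℝ := (p - 1).factorial * (N : ℝ) ^ ((1 - (p : ℝ)) / 2)

theorem skScale_sq_mul_pow (hp : 1 ≤ p) (hN : 0 < N) :
    skScale p N ^ 2 * (N : ℝ) ^ (p - 1) = ((p - 1).factorial : ℝ) ^ 2 := by
  have hN' : (0 : ℝ) < N := by exact_mod_cast hN
  have h : ((N : ℝ) ^ ((1 - (p : ℝ)) / 2)) ^ 2 * (N : ℝ) ^ (p - 1) = 1 := by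
    rw [← Real.rpow_natCast (N : ℝ) (p - 1), ← Real.rpow_natCast _ 2, ← Real.rpow_mul hN'.le,
      ← Real.rpow_add hN', Nat.cast_sub hp]
    push_cast
    rw [show (1 - (p : ℝ)) / 2 * 2 + (p - 1) = 0 by ring, Real.rpow_zero]
  rw [skScale, mul_pow, mul_assoc, h, mul_one]

theorem bilin_coupling (h : Block p N → ℝ) (x : Config N) (u v : Fin N → ℝ) :
    bilin (coupling h x) u v =
      ∑ s : Block p N, h s * spinProd x s.1 * ∑ q ∈ s.1.offDiag, u q.1 * v q.2 := by
  have e : ∀ i j, u i * v j * coupling h x i j =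
      ∑ s : Block p N, if (i, j) ∈ s.1.offDiag then
        h s * spinProd x s.1 * (u i * v j) else 0 := fun i j => by
    rw [coupling]
    split_ifs with hij
    · subst hij; simp
    · rw [Finset.mul_sum]
      refine Finset.sum_congr rfl fun s _ => ?_
      simp only [Finset.mem_offDiag]
      by_cases h1 : i ∈ s.1 <;> by_cases h2 : j ∈ s.1 <;> simp [h1, h2, hij]
      ring
  simp_rw [bilin, e]
  rw [← Fintype.sum_prod_type' fun i j => ∑ s : Block p N, if (i, j) ∈ s.1.offDiag then
        h s * spinProd x s.1 * (u i * v j) else 0, Finset.sum_comm]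
  refine Finset.sum_congr rfl fun s _ => ?_
  rw [← Finset.sum_filter, Finset.mul_sum]
  refine Finset.sum_congr ?_ fun q _ => rfl
  ext; simp

theorem card_blocks_containing_pair_le {i j : Fin N} (hij : i ≠ j) :
    (Finset.univ.filter fun s : Block p N => (i, j) ∈ s.1.offDiag).card ≤ N ^ (p - 2) := by
  calc _ ≤ (Finset.powersetCard (p - 2) (Finset.univ : Finset (Fin N))).card := by
        refine Finset.card_le_card_of_injOn (fun s => (s.1.erase i).erase j) ?_ ?_
        · intro s hs
          have hs' := Finset.mem_offDiag.1 (Finset.mem_filter.1 hs).2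
          refine Finset.mem_coe.2 (Finset.mem_powersetCard.2 ⟨Finset.subset_univ _, ?_⟩)
          rw [Finset.card_erase_of_mem (Finset.mem_erase.2 ⟨hij.symm, hs'.2.1⟩),
            Finset.card_erase_of_mem hs'.1, s.2]
          rfl
        · intro s hs t ht hst
          have hs' := Finset.mem_offDiag.1 (Finset.mem_filter.1 hs).2
          have ht' := Finset.mem_offDiag.1 (Finset.mem_filter.1 ht).2
          have h1 : insert j ((s.1.erase i).erase j) = s.1.erase i :=
            Finset.insert_erase (Finset.mem_erase.2 ⟨hij.symm, hs'.2.1⟩)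
          have h2 : insert j ((t.1.erase i).erase j) = t.1.erase i :=
            Finset.insert_erase (Finset.mem_erase.2 ⟨hij.symm, ht'.2.1⟩)
          have h3 : s.1.erase i = t.1.erase i := by
            rw [← h1, ← h2]
            exact congrArg _ hst
          refine Subtype.ext ?_
          rw [← Finset.insert_erase hs'.1, ← Finset.insert_erase ht'.1, h3]
    _ = N.choose (p - 2) := by simp
    _ ≤ N ^ (p - 2) := Nat.choose_le_pow _ _

/-- Cauchy–Schwarz over the at most `p²` ordered pairs in a block; each pair lies in at most `N ^ (p
- 2)` blocks. -/
theorem sum_pairSum_sq_le (u v : Fin N → ℝ) :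
    ∑ s : Block p N, (∑ q ∈ s.1.offDiag, u q.1 * v q.2) ^ 2 ≤
      (p : ℝ) ^ 2 * ((N : ℝ) ^ (p - 2) * ((∑ i, u i ^ 2) * ∑ j, v j ^ 2)) := by
  have h1 : ∀ s : Block p N, (∑ q ∈ s.1.offDiag, u q.1 * v q.2) ^ 2 ≤
      (p : ℝ) ^ 2 * ∑ q ∈ s.1.offDiag, (u q.1 * v q.2) ^ 2 := fun s => by
    refine (sq_sum_le_card_mul_sum_sq).trans ?_
    have : (s.1.offDiag.card : ℝ) ≤ (p : ℝ) ^ 2 := by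
      rw [Finset.offDiag_card, s.2, sq]
      exact_mod_cast Nat.sub_le _ _
    gcongr
  refine (Finset.sum_le_sum fun s _ => h1 s).trans ?_
  rw [← Finset.mul_sum]
  gcongr
  have h2 : ∑ s : Block p N, ∑ q ∈ s.1.offDiag, (u q.1 * v q.2) ^ 2 =
      ∑ q : Fin N × Fin N,
        ((Finset.univ.filter fun s : Block p N => q ∈ s.1.offDiag).card : ℝ) *
          (u q.1 * v q.2) ^ 2 := by
    have e : ∀ s : Block p N, ∑ q ∈ s.1.offDiag, (u q.1 * v q.2) ^ 2 =
        ∑ q : Fin N × Fin N, if q ∈ s.1.offDiag then (u q.1 * v q.2) ^ 2 else 0 := fun s => by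
      rw [← Finset.sum_filter]
      refine Finset.sum_congr ?_ fun _ _ => rfl
      ext; simp
    rw [Finset.sum_congr rfl fun s _ => e s, Finset.sum_comm]
    refine Finset.sum_congr rfl fun q _ => ?_
    rw [← Finset.sum_filter, Finset.sum_const, nsmul_eq_mul]
  rw [h2, Finset.sum_mul_sum, ← Fintype.sum_prod_type' fun i j => u i ^ 2 * v j ^ 2,
    Finset.mul_sum]
  refine Finset.sum_le_sum fun q _ => ?_
  rw [mul_pow]
  by_cases hq : q.1 = q.2
  · rw [Finset.card_eq_zero.2]
    · simp; positivity
    · refine Finset.filter_eq_empty_iff.2 fun s _ hs => ?_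
      exact (Finset.mem_offDiag.1 hs).2.2 hq
  · have := card_blocks_containing_pair_le (p := p) hq
    have : ((Finset.univ.filter fun s : Block p N => q ∈ s.1.offDiag).card : ℝ) ≤
      (N : ℝ) ^ (p - 2) := by exact_mod_cast this
    gcongr

/-- A bound for the operator norms of the coupling matrices of the model. -/
def couplingConst (p : ℕ) : ℝ := 49 * (p.factorial : ℝ) ^ 2 / 2 + 14

theorem couplingConst_pos (p : ℕ) : 0 < couplingConst p := by
  rw [couplingConst]; positivity

theorem sum_bilin_coeff_sq_le (hp : 2 ≤ p) (hN : 0 < N) (x : Config N) {u v : Fin N → ℝ}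
    (hu : ∑ i, u i ^ 2 ≤ 7 * N) (hv : ∑ i, v i ^ 2 ≤ 7 * N) :
    ∑ s : Block p N, (skScale p N * spinProd x s.1 * ∑ q ∈ s.1.offDiag, u q.1 * v q.2) ^ 2 ≤
      49 * (p.factorial : ℝ) ^ 2 * N := by
  have e : ∀ s : Block p N,
      (skScale p N * spinProd x s.1 * ∑ q ∈ s.1.offDiag, u q.1 * v q.2) ^ 2 =
        skScale p N ^ 2 * (∑ q ∈ s.1.offDiag, u q.1 * v q.2) ^ 2 := fun s => by
    have := spinProd_mul_self x s.1
    rw [mul_pow, mul_pow, sq (spinProd x s.1), this, mul_one]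
  rw [Finset.sum_congr rfl fun s _ => e s, ← Finset.mul_sum]
  obtain ⟨n, rfl⟩ : ∃ n, p = n + 2 := ⟨p - 2, by omega⟩
  have hsc := skScale_sq_mul_pow (p := n + 2) (by omega) hN
  simp only [show n + 2 - 1 = n + 1 from rfl] at hsc
  have hv0 : 0 ≤ ∑ i, v i ^ 2 := Finset.sum_nonneg fun i _ => sq_nonneg _
  have hfac : ((n + 2).factorial : ℝ) = (n + 2) * (n + 1).factorial := by
    rw [Nat.factorial_succ]; push_cast; ring
  calc _ ≤ skScale (n + 2) N ^ 2 * (((n + 2 : ℕ) : ℝ) ^ 2 * ((N : ℝ) ^ (n + 2 - 2) *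
        ((∑ i, u i ^ 2) * ∑ j, v j ^ 2))) := by
        gcongr
        exact sum_pairSum_sq_le u v
    _ ≤ skScale (n + 2) N ^ 2 * (((n + 2 : ℕ) : ℝ) ^ 2 * ((N : ℝ) ^ (n + 2 - 2) *
        ((7 * N) * (7 * N)))) := by gcongr
    _ = 49 * ((n + 2) ^ 2 * (skScale (n + 2) N ^ 2 * (N : ℝ) ^ (n + 1))) * N := by
        rw [Nat.add_sub_cancel, pow_succ]; push_cast; ring
    _ = _ := by rw [hsc, hfac]; ring

/-- For fixed `x`, `z`, `z'` the form is Gaussian with variance at most `49 (p!)² N`, and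
`couplingConst` makes its tail `exp (-14 N)`. This beats the union over spins and two lattice
vectors. -/
theorem measure_not_couplingBound_le (hp : 2 ≤ p) (hN : 0 < N) :
    stdGaussian (Block p N) {y | ¬CouplingBound (fun s => skScale p N * y s) (couplingConst p)} ≤
      ENNReal.ofReal (Real.exp (-N)) := by
  set C := couplingConst p with hC
  set E : Config N → (Fin N → ℤ) → (Fin N → ℤ) → Set (Block p N → ℝ) := fun x z z' =>
    {y | C * N ≤ ∑ s : Block p N,
      (skScale p N * spinProd x s.1 * ∑ q ∈ s.1.offDiag, (z q.1 : ℝ) * z' q.2) * y s} with hE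
  have hsub : {y : Block p N → ℝ | ¬CouplingBound (fun s => skScale p N * y s) C} ⊆
      ⋃ x ∈ (Finset.univ : Finset (Config N)), ⋃ z ∈ latticeBall N, ⋃ z' ∈ latticeBall N,
        E x z z' := by
    intro y hy
    by_contra hcon
    refine hy fun x u v => ?_
    refine bilin_le_of_lattice _ hN (couplingConst_pos p).le (fun z hz z' hz' => ?_) u v
    by_contra! hlt
    refine hcon (Set.mem_biUnion (Finset.mem_univ x) (Set.mem_biUnion hz
      (Set.mem_biUnion hz' (?_ : C * N ≤ _))))
    refine hlt.le.trans (le_of_eq ?_)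
    rw [bilin_coupling]
    exact Finset.sum_congr rfl fun s _ => by ring
  have hone : ∀ x : Config N, ∀ z ∈ latticeBall N, ∀ z' ∈ latticeBall N,
      stdGaussian (Block p N) (E x z z') ≤ ENNReal.ofReal (Real.exp (-(14 * N))) := by
    intro x z hz z' hz'
    have hz1 : ∑ i, (z i : ℝ) ^ 2 ≤ 7 * N := by exact_mod_cast mem_latticeBall.1 hz
    have hz2 : ∑ i, (z' i : ℝ) ^ 2 ≤ 7 * N := by exact_mod_cast mem_latticeBall.1 hz'
    refine (stdGaussian_sum_ge_le _ (sum_bilin_coeff_sq_le hp hN x hz1 hz2) (C * N)).trans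
      (le_of_eq ?_)
    rw [hC, couplingConst]
    congr 2
    ring
  calc _ ≤ stdGaussian (Block p N) (⋃ x ∈ (Finset.univ : Finset (Config N)),
        ⋃ z ∈ latticeBall N, ⋃ z' ∈ latticeBall N, E x z z') := measure_mono hsub
    _ ≤ ∑ _x : Config N, ∑ _z ∈ latticeBall N, ∑ _z' ∈ latticeBall N,
        ENNReal.ofReal (Real.exp (-(14 * N))) := by
        refine (measure_biUnion_finset_le _ _).trans (Finset.sum_le_sum fun x _ => ?_)
        refine (measure_biUnion_finset_le _ _).trans (Finset.sum_le_sum fun z hz => ?_)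
        exact (measure_biUnion_finset_le _ _).trans
          (Finset.sum_le_sum fun z' hz' => hone x z hz z' hz')
    _ = ENNReal.ofReal (2 ^ N * ((latticeBall N).card * ((latticeBall N).card *
          Real.exp (-(14 * N))))) := by
        rw [Finset.sum_const, Finset.sum_const, Finset.sum_const, nsmul_eq_mul, nsmul_eq_mul,
          nsmul_eq_mul, ENNReal.ofReal_mul (by positivity), ENNReal.ofReal_mul (by positivity),
          ENNReal.ofReal_mul (by positivity), ENNReal.ofReal_natCast, ENNReal.ofReal_pow (by simp)]
        simp [Fintype.card_units_int]
    _ ≤ _ := by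
        refine ENNReal.ofReal_le_ofReal ?_
        have hc := card_latticeBall_le N
        -- `294912 = 2 · 384²` is the base of the number of events in the union.
        have h13 : (294912 : ℝ) ≤ Real.exp 13 := by
          have h1 : (2.7 : ℝ) ≤ Real.exp 1 := by linarith [Real.exp_one_gt_d9]
          calc (294912 : ℝ) ≤ 2.7 ^ 13 := by norm_num
            _ ≤ Real.exp 1 ^ 13 := by gcongr
            _ = Real.exp 13 := by rw [← Real.exp_nat_mul]; norm_num
        calc _ ≤ (2 : ℝ) ^ N * (384 ^ N * (384 ^ N * Real.exp (-(14 * N)))) := by gcongr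
          _ = 294912 ^ N * Real.exp (-(14 * N)) := by
            rw [← mul_assoc, ← mul_assoc, ← mul_pow, ← mul_pow]; norm_num
          _ ≤ Real.exp 13 ^ N * Real.exp (-(14 * N)) := by gcongr
          _ = Real.exp (-N) := by
            rw [← Real.exp_nat_mul, ← Real.exp_add]; congr 1; ring

end Disorder

/-! ### Most configurations of fields are not small -/

section SmallBall

open scoped ENNReal

variable {p N : ℕ}

/-- The first half of the vertices. -/
def lowerHalf (N : ℕ) : Finset (Fin N) := Finset.univ.filter fun i => 2 * (i : ℕ) < N

theorem card_lowerHalf (N : ℕ) : (lowerHalf N).card = (N + 1) / 2 := by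
  have e : (lowerHalf N).map Fin.valEmbedding = Finset.range ((N + 1) / 2) := by
    ext k
    simp only [lowerHalf, Finset.mem_map, Finset.mem_filter, Finset.mem_univ, true_and,
      Fin.valEmbedding_apply, Finset.mem_range]
    constructor
    · rintro ⟨i, hi, rfl⟩; omega
    · intro hk
      exact ⟨⟨k, by omega⟩, by simp only; omega, rfl⟩
  rw [← Finset.card_map Fin.valEmbedding, e, Finset.card_range]

/-- The `p`-sets that consist of `i` and of vertices of the first half. -/
def privateBlocks (p : ℕ) {N : ℕ} (i : Fin N) : Finset (Block p N) :=
  Finset.univ.filter fun s => i ∈ s.1 ∧ s.1.erase i ⊆ lowerHalf N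

theorem choose_le_card_privateBlocks (hp : 1 ≤ p) {i : Fin N} (hi : i ∉ lowerHalf N) :
    ((N + 1) / 2).choose (p - 1) ≤ (privateBlocks p i).card := by
  rw [← card_lowerHalf, ← Finset.card_powersetCard,
    ← Finset.card_map (Function.Embedding.subtype _) (s := privateBlocks p i)]
  refine Finset.card_le_card_of_injOn (fun t => insert i t) ?_ ?_
  · intro t ht
    obtain ⟨h1, h2⟩ := Finset.mem_powersetCard.1 ht
    have hit : i ∉ t := fun h => hi (h1 h)
    refine Finset.mem_coe.2 (Finset.mem_map.2
      ⟨⟨insert i t, by rw [Finset.card_insert_of_notMem hit]; omega⟩, ?_, rfl⟩)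
    simp only [privateBlocks, Finset.mem_filter, Finset.mem_univ, true_and]
    exact ⟨Finset.mem_insert_self _ _, by rwa [Finset.erase_insert hit]⟩
  · intro t ht t' ht' htt
    have hit : i ∉ t := fun h => hi ((Finset.mem_powersetCard.1 ht).1 h)
    have hit' : i ∉ t' := fun h => hi ((Finset.mem_powersetCard.1 ht').1 h)
    rw [← Finset.erase_insert hit, ← Finset.erase_insert hit']
    exact congrArg (fun s : Finset (Fin N) => s.erase i) htt

/-- The coefficients of the cavity field at `i` as a linear form in the disorder. -/
def cavityCoeff (p : ℕ) {N : ℕ} (x : Config N) (i : Fin N) (s : Block p N) : ℝ :=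
  if i ∈ s.1 then skScale p N * spinProd x s.1 else 0

theorem cavity_eq_sum_cavityCoeff (x : Config N) (i : Fin N) (y : Block p N → ℝ) :
    cavity (fun s => skScale p N * y s) x i = ∑ s, cavityCoeff p x i s * y s := by
  refine Finset.sum_congr rfl fun s _ => ?_
  rw [cavityCoeff]
  split_ifs <;> ring

/-- There are at least `(N/4) ^ (p - 1) / (p - 1)!` private blocks, each with squared coefficient
`((p - 1)!)² N ^ (1 - p)`. -/
theorem sum_cavityCoeff_sq_ge (hp : 1 ≤ p) (hN : 4 * p ≤ N) (x : Config N) {i : Fin N}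
    (hi : i ∉ lowerHalf N) :
    ((1 / 2 : ℝ) ^ (p - 1)) ^ 2 ≤ ∑ s ∈ privateBlocks p i, cavityCoeff p x i s ^ 2 := by
  have e : ∀ s ∈ privateBlocks p i, cavityCoeff p x i s ^ 2 = skScale p N ^ 2 := fun s hs => by
    rw [cavityCoeff, if_pos (Finset.mem_filter.1 hs).2.1, mul_pow, sq (spinProd x s.1),
      spinProd_mul_self, mul_one]
  rw [Finset.sum_congr rfl e, Finset.sum_const, nsmul_eq_mul]
  have hsc := skScale_sq_mul_pow (p := p) (N := N) hp (by omega)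
  have h1 : ((((N + 1) / 2).choose (p - 1) : ℕ) : ℝ) ≤ (privateBlocks p i).card := by
    exact_mod_cast choose_le_card_privateBlocks hp hi
  have h2 := Nat.pow_le_choose (α := ℝ) (p - 1) ((N + 1) / 2)
  have h3 : (N : ℝ) / 4 ≤ (((N + 1) / 2 + 1 - (p - 1) : ℕ) : ℝ) := by
    have : N ≤ 4 * ((N + 1) / 2 + 1 - (p - 1)) := by omega
    have : (N : ℝ) ≤ 4 * (((N + 1) / 2 + 1 - (p - 1) : ℕ) : ℝ) := by exact_mod_cast this
    linarith
  have hfac : (1 : ℝ) ≤ (p - 1).factorial := by exact_mod_cast Nat.factorial_pos _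
  have h4 : ((N : ℝ) / 4) ^ (p - 1) / (p - 1).factorial ≤ (privateBlocks p i).card := by
    refine le_trans ?_ (h2.trans h1)
    gcongr
  calc ((1 / 2 : ℝ) ^ (p - 1)) ^ 2 = (1 / 4) ^ (p - 1) * 1 := by
        rw [← pow_mul, mul_comm (p - 1) 2, pow_mul]; norm_num
    _ ≤ (1 / 4) ^ (p - 1) * ((p - 1).factorial : ℝ) := by gcongr
    _ = ((N : ℝ) / 4) ^ (p - 1) / (p - 1).factorial * skScale p N ^ 2 := by
        have : ((N : ℝ) / 4) ^ (p - 1) / (p - 1).factorial * skScale p N ^ 2 =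
          (1 / 4) ^ (p - 1) * (skScale p N ^ 2 * (N : ℝ) ^ (p - 1)) / (p - 1).factorial := by
          rw [div_eq_mul_one_div (N : ℝ) 4, mul_pow]; ring
        rw [this, hsc]
        field_simp
    _ ≤ (privateBlocks p i).card * skScale p N ^ 2 := by gcongr

theorem cavityCoeff_eq_zero {x : Config N} {i j : Fin N} (hj : j ∉ lowerHalf N) (hij : i ≠ j)
    {s : Block p N} (hs : s ∈ privateBlocks p i) : cavityCoeff p x j s = 0 :=
  if_neg fun h => hj ((Finset.mem_filter.1 hs).2.2 (Finset.mem_erase.2 ⟨hij.symm, h⟩))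

/-- A threshold that most cavity fields exceed. -/
def fieldFloor (p : ℕ) : ℝ := (1 / 2) ^ (p - 1) * (1 / 2) ^ 10

theorem fieldFloor_pos (p : ℕ) : 0 < fieldFloor p := by
  rw [fieldFloor]; positivity

/-- At least a tenth of the cavity fields exceed `ε`, for every configuration. -/
def FieldsLarge {p N : ℕ} (h : Block p N → ℝ) (ε : ℝ) : Prop :=
  ∀ x : Config N, N ≤ 10 * (Finset.univ.filter fun i => ε < |cavity h x i|).card

theorem prod_smallWeight_ge (h : Block p N → ℝ) (x : Config N) (ε : ℝ) (B : Finset (Fin N))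
    (hc : 10 * (Finset.univ.filter fun i => ε < |cavity h x i|).card ≤ N) :
    (2⁻¹ : ℝ≥0∞) ^ N ≤ ∏ i ∈ B, smallWeight ε (2⁻¹ ^ 10) (cavity h x i) := by
  have h1 : (2⁻¹ : ℝ≥0∞) ≤ 1 := ENNReal.inv_le_one.2 one_le_two
  have e : ∏ i ∈ B, smallWeight ε (2⁻¹ ^ 10) (cavity h x i) =
      (2⁻¹ ^ 10) ^ (B.filter fun i => ε < |cavity h x i|).card := by
    rw [← Finset.prod_const, Finset.prod_filter]
    refine Finset.prod_congr rfl fun i _ => ?_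
    rw [smallWeight]
    by_cases hi : ε < |cavity h x i|
    · rw [if_neg (not_le.2 hi), if_pos hi]
    · rw [if_pos (not_lt.1 hi), if_neg hi]
  rw [e, ← pow_mul]
  refine pow_le_pow_right_of_le_one' h1 ((Nat.mul_le_mul_left 10 (Finset.card_le_card ?_)).trans hc)
  exact Finset.filter_subset_filter _ (Finset.subset_univ B)

/-- For fixed `x`, too few large fields force the product of weights above `2 ^ (-N)`, while its
mean is at most `2 ^ (-3 N)`. Markov's inequality gives `2 ^ (-2 N)`, enough for the union over `2 ^
N` configurations. -/
theorem measure_not_fieldsLarge_le (hp : 1 ≤ p) (hN : 4 * p ≤ N) :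
    stdGaussian (Block p N) {y | ¬FieldsLarge (fun s => skScale p N * y s) (fieldFloor p)} ≤
      2⁻¹ ^ N := by
  classical
  set B : Finset (Fin N) := (lowerHalf N)ᶜ with hB
  have hBc : N ≤ 3 * B.card := by
    rw [hB, Finset.card_compl, card_lowerHalf, Fintype.card_fin]
    omega
  set E : Config N → Set (Block p N → ℝ) := fun x => {y | (2⁻¹ : ℝ≥0∞) ^ N ≤
    ∏ i ∈ B, smallWeight (fieldFloor p) (2⁻¹ ^ 10) (∑ s, cavityCoeff p x i s * y s)} with hE
  have hsub : {y : Block p N → ℝ | ¬FieldsLarge (fun s => skScale p N * y s) (fieldFloor p)} ⊆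
      ⋃ x ∈ (Finset.univ : Finset (Config N)), E x := by
    intro y hy
    obtain ⟨x, hx⟩ := not_forall.1 hy
    refine Set.mem_biUnion (Finset.mem_univ x) ?_
    have := prod_smallWeight_ge _ x (fieldFloor p) B (not_le.1 hx).le
    simp only [cavity_eq_sum_cavityCoeff] at this
    exact this
  have h2 : (2⁻¹ : ℝ≥0∞) ≠ 0 := by simp
  have h2' : (2⁻¹ : ℝ≥0∞) ≠ ∞ := by simp
  have hσ : (0 : ℝ) < (1 / 2) ^ (p - 1) := by positivity
  have hone : ∀ x, stdGaussian (Block p N) (E x) ≤ 2⁻¹ ^ N * 2⁻¹ ^ N := by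
    intro x
    have hint := lintegral_prod_smallWeight_le (cavityCoeff p x) (privateBlocks p) hσ
      (ε := fieldFloor p) (2⁻¹ ^ 10) B
      (fun i hi => sum_cavityCoeff_sq_ge hp hN x (Finset.mem_compl.1 hi))
      fun i _ j hj hij s hs => cavityCoeff_eq_zero (Finset.mem_compl.1 hj) hij hs
    -- `fieldFloor` makes the small ball probability equal to the weight `2 ^ (-10)`. With `9` bits
    -- per vertex and at least `N / 3` vertices, the exponent is `3 N`.
    have hk : (2⁻¹ : ℝ≥0∞) ^ 10 + ENNReal.ofReal (fieldFloor p / (1 / 2) ^ (p - 1)) =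
        2⁻¹ ^ 9 := by
      rw [fieldFloor, mul_div_cancel_left₀ _ hσ.ne', ENNReal.ofReal_pow (by norm_num), one_div,
        ENNReal.ofReal_inv_of_pos (by norm_num), ENNReal.ofReal_ofNat, pow_succ, ← mul_add,
        ENNReal.inv_two_add_inv_two, mul_one]
    rw [hk, ← pow_mul] at hint
    have hm : Measurable fun y : Block p N → ℝ =>
        ∏ i ∈ B, smallWeight (fieldFloor p) (2⁻¹ ^ 10) (∑ s, cavityCoeff p x i s * y s) :=
      Finset.measurable_prod _ fun i _ => (measurable_smallWeight _ _).comp (by fun_prop)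
    refine (meas_ge_le_lintegral_div hm.aemeasurable (pow_ne_zero _ h2)
      (ENNReal.pow_ne_top h2')).trans ?_
    refine ENNReal.div_le_of_le_mul (hint.trans ?_)
    rw [← pow_add, ← pow_add]
    exact pow_le_pow_right_of_le_one' (ENNReal.inv_le_one.2 one_le_two) (by omega)
  calc _ ≤ stdGaussian (Block p N) (⋃ x ∈ (Finset.univ : Finset (Config N)), E x) :=
        measure_mono hsub
    _ ≤ ∑ _x : Config N, (2⁻¹ : ℝ≥0∞) ^ N * 2⁻¹ ^ N :=
        (measure_biUnion_finset_le _ _).trans (Finset.sum_le_sum fun x _ => hone x)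
    _ = 2⁻¹ ^ N := by
        rw [Finset.sum_const, nsmul_eq_mul, ← mul_assoc]
        have : ((Finset.univ : Finset (Config N)).card : ℝ≥0∞) = 2 ^ N := by
          simp [Fintype.card_units_int]
        rw [this, ← mul_pow, ENNReal.mul_inv_cancel two_ne_zero ENNReal.ofNat_ne_top, one_pow,
          one_mul]

/-- The bound on `∑ c_i²` leaves at most `N / 36` fields above `6 C`, and `1/10 - 1/36 ≥ 1/14`. -/
theorem FieldsLarge.fieldsSpread {h : Block p N → ℝ} {ε C : ℝ} (hl : FieldsLarge h ε)
    (hp : 2 ≤ p) (hC : 0 < C) (hb : CouplingBound h C) : FieldsSpread h ε (6 * C) := by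
  intro x
  have h1 : (N : ℝ) ≤ 10 * ((Finset.univ.filter fun i => ε < |cavity h x i|).card : ℝ) := by
    exact_mod_cast hl x
  have h2 : (36 * C ^ 2) * ((Finset.univ.filter fun i => 6 * C < |cavity h x i|).card : ℝ) ≤
      C ^ 2 * N := by
    refine le_trans ?_ (hb.sum_cavity_sq_le hp hC x)
    calc _ = ∑ i with 6 * C < |cavity h x i|, 36 * C ^ 2 := by
          rw [Finset.sum_const, nsmul_eq_mul, mul_comm]
      _ ≤ ∑ i with 6 * C < |cavity h x i|, cavity h x i ^ 2 := by
          refine Finset.sum_le_sum fun i hi => ?_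
          have := (Finset.mem_filter.1 hi).2
          rw [← sq_abs (cavity h x i)]
          nlinarith
      _ ≤ _ := Finset.sum_le_univ_sum_of_nonneg fun i => sq_nonneg _
  have h3 : 36 * ((Finset.univ.filter fun i => 6 * C < |cavity h x i|).card : ℝ) ≤ N := by
    have : C ^ 2 * (36 * ((Finset.univ.filter fun i => 6 * C < |cavity h x i|).card : ℝ)) ≤
      C ^ 2 * N := by linarith
    exact le_of_mul_le_mul_left this (by positivity)
  have h4 : (Finset.univ.filter fun i => ε < |cavity h x i|).card ≤
      (Finset.univ.filter fun i => ε < |cavity h x i| ∧ |cavity h x i| ≤ 6 * C).card +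
        (Finset.univ.filter fun i => 6 * C < |cavity h x i|).card := by
    refine (Finset.card_le_card ?_).trans (Finset.card_union_le _ _)
    intro i hi
    have hi' := (Finset.mem_filter.1 hi).2
    rcases le_or_gt |cavity h x i| (6 * C) with hle | hlt
    · exact Finset.mem_union_left _ (by simp [hi', hle])
    · exact Finset.mem_union_right _ (by simp [hlt])
  have h5 : ((Finset.univ.filter fun i => ε < |cavity h x i|).card : ℝ) ≤
      (Finset.univ.filter fun i => ε < |cavity h x i| ∧ |cavity h x i| ≤ 6 * C).card +
        (Finset.univ.filter fun i => 6 * C < |cavity h x i|).card := by exact_mod_cast h4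
  have h6 : (0 : ℝ) ≤ N := Nat.cast_nonneg N
  linarith

end SmallBall

/-! ### Borel–Cantelli and conclusion -/

/-- Almost surely, the coupling matrices are bounded and the cavity fields are spread out
for all large system sizes. -/
theorem ae_eventually_couplingBound_and_fieldsSpread {p : ℕ} (hp : 2 ≤ p) {Ω : Type*}
    [MeasurableSpace Ω] {μ : Measure Ω} {g : DisorderIndex p → Ω → ℝ}
    (hg : ∀ s, HasLaw (g s) (gaussianReal 0 1) μ) (hi : iIndepFun g μ) :
    ∀ᵐ ω ∂μ, ∀ᶠ N : ℕ in atTop,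
      CouplingBound (skCoupling p (fun s => g s ω) N) (couplingConst p) ∧
      FieldsSpread (skCoupling p (fun s => g s ω) N) (fieldFloor p) (6 * couplingConst p) := by
  let emb : ∀ N, Block p N → DisorderIndex p :=
    fun N s => ⟨s.1.map Fin.valEmbedding, by simp [s.2]⟩
  have hemb : ∀ N, Function.Injective (emb N) := fun N s t hst =>
    Subtype.ext (Finset.map_injective Fin.valEmbedding (congrArg Subtype.val hst))
  have hlaw : ∀ N, HasLaw (fun ω (s : Block p N) => g (emb N s) ω)
      (stdGaussian (Block p N)) μ := fun N =>
    iIndepFun.hasLaw_pi (fun s => hg (emb N s)) (hi.precomp (hemb N))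
  -- The one-sided inequality needs no measurability of `A`.
  have htransfer : ∀ (N : ℕ) (A : Set (Block p N → ℝ)),
      μ {ω | (fun s => g (emb N s) ω) ∈ A} ≤ stdGaussian (Block p N) A := fun N A => by
    rw [← (hlaw N).map_eq]
    exact Measure.le_map_apply (hlaw N).aemeasurable A
  have h1 : ∀ᵐ ω ∂μ, ∀ᶠ N : ℕ in atTop, ω ∉ {ω | 0 < N ∧
      ¬CouplingBound (skCoupling p (fun s => g s ω) N) (couplingConst p)} := by
    refine ae_eventually_notMem (ne_top_of_le_ne_top ?_ (ENNReal.tsum_le_tsum fun N =>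
      (?_ : _ ≤ ENNReal.ofReal (Real.exp (-N)))))
    · exact (Real.summable_exp_neg_nat).tsum_ofReal_ne_top
    · rcases Nat.eq_zero_or_pos N with h0 | h0
      · simp [h0]
      · refine (measure_mono fun ω hω => ?_).trans
          ((htransfer N _).trans (measure_not_couplingBound_le hp h0))
        exact hω.2
  have h2 : ∀ᵐ ω ∂μ, ∀ᶠ N : ℕ in atTop, ω ∉ {ω | 4 * p ≤ N ∧
      ¬FieldsLarge (skCoupling p (fun s => g s ω) N) (fieldFloor p)} := by
    refine ae_eventually_notMem (ne_top_of_le_ne_top ?_ (ENNReal.tsum_le_tsum fun N =>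
      (?_ : _ ≤ (2⁻¹ : ENNReal) ^ N)))
    · rw [ENNReal.tsum_geometric]
      simp
    · by_cases h0 : 4 * p ≤ N
      · refine (measure_mono fun ω hω => ?_).trans
          ((htransfer N _).trans (measure_not_fieldsLarge_le (by omega) h0))
        exact hω.2
      · simp [h0]
  filter_upwards [h1, h2] with ω hω1 hω2
  filter_upwards [hω1, hω2, eventually_ge_atTop (4 * p)] with N hN1 hN2 hN
  have hb : CouplingBound (skCoupling p (fun s => g s ω) N) (couplingConst p) := by
    by_contra hcon
    exact hN1 ⟨by omega, hcon⟩
  have hl : FieldsLarge (skCoupling p (fun s => g s ω) N) (fieldFloor p) := by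
    by_contra hcon
    exact hN2 ⟨hN, hcon⟩
  exact ⟨hb, hl.fieldsSpread hp (couplingConst_pos p) hb⟩

theorem scoreConst_pos {C q : ℝ} (hC : 0 < C) (hq : 0 ≤ q) : 0 < scoreConst C q := by
  rw [scoreConst]; positivity

end TensorIsing

end

theorem corollary3p2 (p : ℕ) [NeZero p] (hp : 2 ≤ p) :
    ∃ M : ℝ → ℝ → ℝ, (∀ β > 0, ∀ δ > 0, 0 < M β δ) ∧
      ∀ (Ω : Type*) [MeasurableSpace Ω] (μ : Measure Ω) [IsProbabilityMeasure μ]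
        (g : TensorIsing.DisorderIndex p → Ω → ℝ),
        (∀ s, HasLaw (g s) (gaussianReal 0 1) μ) → iIndepFun g μ →
        ∀ᵐ ω ∂μ, ∀ β > 0, ∀ δ > 0, ∀ᶠ N : ℕ in atTop,
          1 - δ < TensorIsing.gibbsProb (TensorIsing.skTensor p (fun s => g s ω) N) β
            {x | ENNReal.ofReal √N *
                (TensorIsing.mple (TensorIsing.skTensor p (fun s => g s ω) N) x - (β : EReal)).abs
              ≤ ENNReal.ofReal (M β δ)} := by
  have hp0 : 0 < p := by omega
  set C := TensorIsing.couplingConst p with hC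
  have hC0 : 0 < C := TensorIsing.couplingConst_pos p
  -- Chebyshev then loses only `δ / 2`, giving the strict inequality.
  let L : ℝ → ℝ → ℝ := fun β δ => 2 * TensorIsing.scoreConst C (p * β) / δ
  have hV : ∀ β > 0, 0 < TensorIsing.scoreConst C (p * β) := fun β hβ =>
    TensorIsing.scoreConst_pos hC0 (by positivity)
  have hL : ∀ β > 0, ∀ δ > 0, 0 < L β δ := fun β hβ δ hδ => by
    have := hV β hβ
    positivity
  have hκ : ∀ β, 0 < TensorIsing.slopeConst p (TensorIsing.fieldFloor p) (6 * C) (2 * β) :=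
    fun β => TensorIsing.slopeConst_pos hp0 (TensorIsing.fieldFloor_pos p) _ _
  refine ⟨fun β δ => √(L β δ) /
    TensorIsing.slopeConst p (TensorIsing.fieldFloor p) (6 * C) (2 * β), fun β hβ δ hδ =>
    div_pos (Real.sqrt_pos.2 (hL β hβ δ hδ)) (hκ β), ?_⟩
  intro Ω _ μ _ g hg hi
  -- The event is fixed before `β` and `δ`; its constants depend on `p` alone.
  filter_upwards [TensorIsing.ae_eventually_couplingBound_and_fieldsSpread hp hg hi] with ω hω
  intro β hβ δ hδ
  have hlim : Tendsto (fun N : ℕ => √(L β δ) /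
      TensorIsing.slopeConst p (TensorIsing.fieldFloor p) (6 * C) (2 * β) / √(N : ℝ)) atTop
      (nhds 0) :=
    tendsto_const_nhds.div_atTop (Real.tendsto_sqrt_atTop.comp tendsto_natCast_atTop_atTop)
  filter_upwards [hω, hlim.eventually_le_const hβ, eventually_gt_atTop 0] with N hN hlarge hN0
  have h := TensorIsing.gibbsProb_ge_of_score hp hC0 hN.1 hβ.le hN0 (hL β hβ δ hδ)
    fun x hx => hN.2.abs_mple_sub_le (TensorIsing.fieldFloor_pos p) (hL β hβ δ hδ).le hN0
      hlarge hx
  refine lt_of_lt_of_le ?_ h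
  have : TensorIsing.scoreConst C (p * β) / L β δ = δ / 2 := by
    have := (hV β hβ).ne'
    simp only [L]
    field_simp
  rw [this]
  linarith
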